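/- Let $G=\mathbb{R}^3$ be the Heisenberg group with the product $(x,y,z)(x',y',z')=(x+x',\,y+y',\,z+z'+(xy'-x'y))$, let $\Gamma=\mathbb{Z}^3\subset G$ be the subgroup of integer points, and let $X=G/\Gamma$ with the quotient topology, on which $G$ acts by left translation. Write $\mathbb{T}^1=\mathbb{R}/\mathbb{Z}$ and $\mathbb{T}^2=\mathbb{R}^2/\mathbb{Z}^2$. Let $\alpha,\beta\in\mathbb{R}$ be such that $\alpha,\beta,1$ are linearly independent over $\mathbb{Q}$, and let $h:\mathbb{T}^2\to\mathbb{T}^1$ be Lipschitz continuous. Define $T:X\to X$ by $$T(\mathbf{x})=(\alpha,\beta,\tilde h(x,y))\,\mathbf{x}\qquad\text{for }\mathbf{x}=(x,y,z)\Gamma,$$ where $\tilde h(x,y)\in\mathbb{R}$ is any lift of $h(x \bmod 1,\,y \bmod 1)\in\mathbb{T}^1$ ($T$ does not depend on the choice of the lift or of the representative $(x,y,z)$). Then for every $\mathbf{x}\in X$ and every continuous $f:X\to\mathbb{C}$, $$\lim_{N\to\infty}\frac1N\sum_{n=1}^{N}f(T^n\mathbf{x})\,\mu(n)=0,$$ where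 $\mu$ is the Möbius function. -/

import Mathlib

/-- The real Heisenberg group, as triples of real numbers. -/
@[ext]
structure Heis where
  x : ℝ
  y : ℝ
  z : ℝ

namespace Heis

/-- `(x,y,z)(x',y',z') = (x+x', y+y', z+z'+(xy'-x'y))`. -/
instance : Mul Heis :=
  ⟨fun a b => ⟨a.x + b.x, a.y + b.y, a.z + b.z + (a.x * b.y - b.x * a.y)⟩⟩

instance : One Heis := ⟨⟨0, 0, 0⟩⟩

instance : Inv Heis := ⟨fun a => ⟨-a.x, -a.y, -a.z⟩⟩

theorem mul_def (a b : Heis) :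
    a * b = ⟨a.x + b.x, a.y + b.y, a.z + b.z + (a.x * b.y - b.x * a.y)⟩ := rfl

theorem one_def : (1 : Heis) = ⟨0, 0, 0⟩ := rfl

theorem inv_def (a : Heis) : a⁻¹ = ⟨-a.x, -a.y, -a.z⟩ := rfl

instance : Group Heis :=
  Group.ofLeftAxioms
    (by intro a b c; simp only [mul_def]; ext <;> simp only [] <;> ring)
    (by intro a; simp only [mul_def, one_def]; ext <;> simp)
    (by intro a; simp only [mul_def, one_def, inv_def]; ext <;> simp only [] <;> ring)

/-- The identification of the Heisenberg group with `ℝ³` as a set. -/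
def equivProd : Heis ≃ ℝ × ℝ × ℝ where
  toFun a := (a.x, a.y, a.z)
  invFun p := ⟨p.1, p.2.1, p.2.2⟩
  left_inv _ := rfl
  right_inv _ := rfl

/-- The usual topology of `ℝ³`. -/
instance : TopologicalSpace Heis := TopologicalSpace.induced equivProd inferInstance

/-- The lattice of integer points. -/
def lattice : Subgroup Heis where
  carrier := {g | ∃ a b c : ℤ, g = ⟨a, b, c⟩}
  mul_mem' := by
    rintro _ _ ⟨a, b, c, rfl⟩ ⟨a', b', c', rfl⟩
    exact ⟨a + a', b + b', c + c' + (a * b' - a' * b), by simp [mul_def]⟩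
  one_mem' := ⟨0, 0, 0, by simp [one_def]⟩
  inv_mem' := by
    rintro _ ⟨a, b, c, rfl⟩
    exact ⟨-a, -b, -c, by simp [inv_def]⟩

end Heis

/-- The Heisenberg nilmanifold `G/Γ` (left cosets `gΓ`), with the quotient topology and the
action of `G` by left translation. -/
abbrev HeisNil : Type := Heis ⧸ Heis.lattice

namespace HeisNil

/-- The projection `(x,y,z)Γ ↦ (x mod 1, y mod 1)` to the two-dimensional torus. -/
noncomputable def toTorus : HeisNil → UnitAddCircle × UnitAddCircle :=
  Quotient.lift (fun g : Heis => ((g.x : UnitAddCircle), (g.y : UnitAddCircle))) (by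
    intro g g' h
    obtain ⟨a, b, c, hγ⟩ := QuotientGroup.leftRel_apply.mp h
    have hg : g' = g * ⟨a, b, c⟩ := by rw [← hγ]; group
    subst hg
    simp [Heis.mul_def])

/-- The skew product `𝐱 ↦ (α, β, h(x,y)) 𝐱` for `𝐱 = (x,y,z)Γ`, where the value `h(x,y) ∈ ℝ/ℤ` is
lifted to its representative in `[0,1)`; see `skew_mk` for the independence of the lift. -/
noncomputable def skew (α β : ℝ) (h : UnitAddCircle × UnitAddCircle → UnitAddCircle)
    (p : HeisNil) : HeisNil :=
  (⟨α, β, (AddCircle.equivIco (1 : ℝ) 0 (h (toTorus p)) : ℝ)⟩ : Heis) • p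

/-- Any lift `t` of `h(x,y)` to `ℝ` gives the same map. -/
theorem skew_mk (α β : ℝ) (h : UnitAddCircle × UnitAddCircle → UnitAddCircle) (g : Heis) (t : ℝ)
    (ht : (t : UnitAddCircle) = h ((g.x : UnitAddCircle), (g.y : UnitAddCircle))) :
    skew α β h (QuotientGroup.mk g) = QuotientGroup.mk ((⟨α, β, t⟩ : Heis) * g) := by
  have key : toTorus (QuotientGroup.mk g) = ((g.x : UnitAddCircle), (g.y : UnitAddCircle)) := rfl
  have hs : ((AddCircle.equivIco (1 : ℝ) 0 (t : UnitAddCircle) : ℝ) : UnitAddCircle) = t :=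
    (AddCircle.equivIco (1 : ℝ) 0).symm_apply_apply _
  unfold skew
  rw [key, ← ht]
  generalize (AddCircle.equivIco (1 : ℝ) 0 (t : UnitAddCircle) : ℝ) = s at hs
  obtain ⟨m, hm⟩ := (AddCircle.coe_eq_zero_iff (1 : ℝ) (x := t - s)).mp (by simp [hs])
  have hm' : t = s + m := by simp at hm; linarith
  refine QuotientGroup.eq.mpr ⟨0, 0, m, ?_⟩
  simp only [Heis.mul_def, Heis.inv_def, hm', smul_eq_mul]
  ext <;> simp only [Int.cast_zero] <;> ring

end HeisNil

open Finset Filter Topology MeasureTheory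
open scoped ComplexConjugate FourierTransform
open UnitAddTorus (mFourier mFourierCoeff)

/-! By the Kátai–Bourgain–Sarnak–Ziegler criterion (`tendsto_moebius_of_correlations`), a bounded
sequence `u` is orthogonal to `μ` once `u(pn) conj u(qn)` has mean zero for all distinct primes `p`,
`q`. Averaging along the central direction against trigonometric polynomials reduces a continuous
function on the nilmanifold to functions `F` with `F(x,y,z+s) = e(ms) F(x,y,z)` for one integer `m`
(`exists_vertical_kernel`).

If `m = 0`, then `F` lives on the torus and is sampled along the rotation by `(α,β)`. Nontrivial
characters satisfy the criterion by geometric sums; the trivial one is the prime number theorem,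
deduced from a Tauberian theorem and the absence of zeros of `ζ` on `Re s ≥ 1`.

If `m ≠ 0`, then `u(n+k) conj u(n)` is a continuous function `G_k` of the base point on the torus,
because the vertical phases cancel. By van der Corput's criterion and Weyl equidistribution it
suffices that `∫ G_{pk}(w₀+pw) conj G_{qk}(w₀+qw) dw → 0` as `k → ∞`. Write `h = h₀ + Ax + By` with
`h₀` real-valued on the torus and `A`, `B` integers. Translating `w` by `(0, s/k)` multiplies
`G_{pk}(w₀+pw)` by nearly the constant `e(m p²(B+2α)s)`, up to an `L¹` error tending to zero: the
twist of the group and the degree `B` give the phase, while the contribution of `h₀` is a sum of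
`pk` increments of size `O(1/k)` along a minimal rotation, which tends to zero in `L²`
(`tendsto_integral_sq_sum_increments`). Since `m(B+2α)(p²-q²) ≠ 0`, some `s` makes the two phases
combine to `-1`. The integral is then nearly its own negative
(`tendsto_integral_torus_correlation`).

The Lipschitz condition enters only through the vertical increments of `h₀`: by Parseval it makes `∑
|ξ₂|² |ĥ₀(ξ)|²` converge. -/

/-! ### The Kátai–Bourgain–Sarnak–Ziegler criterion -/

theorem sum_filter_dvd_Icc {E : Type*} [AddCommMonoid E] (g : ℕ → E) {p : ℕ} (hp : 0 < p) (N : ℕ) :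
    ∑ n ∈ Icc 1 N with p ∣ n, g n = ∑ m ∈ Icc 1 (N / p), g (p * m) := by
  symm
  refine Finset.sum_bij (fun m _ => p * m) ?_ ?_ ?_ ?_
  · intro m hm
    rw [mem_Icc] at hm
    rw [mem_filter, mem_Icc]
    refine ⟨⟨Nat.mul_pos hp hm.1, ?_⟩, dvd_mul_right _ _⟩
    calc p * m ≤ p * (N / p) := Nat.mul_le_mul_left _ hm.2
      _ ≤ N := Nat.mul_div_le N p
  · intro a _ b _ hab
    exact Nat.eq_of_mul_eq_mul_left hp hab
  · intro n hn
    rw [mem_filter, mem_Icc] at hn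
    obtain ⟨⟨h1, h2⟩, m, rfl⟩ := hn
    refine ⟨m, ?_, rfl⟩
    rw [mem_Icc]
    exact ⟨Nat.pos_of_mul_pos_left h1, (Nat.le_div_iff_mul_le hp).2 (by rwa [mul_comm])⟩
  · intros; rfl

theorem card_filter_dvd_Icc {p : ℕ} (hp : 0 < p) (N : ℕ) : #{n ∈ Icc 1 N | p ∣ n} = N / p := by
  have := sum_filter_dvd_Icc (fun _ => 1) hp N
  simpa using this

/-- The Turán–Kubilius inequality for a finite set of primes. Expand the square: distinct primes
divide `n` jointly at most `N/(pq)` times, the diagonal contributes at most `N/p` per prime, and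
rounding in the first moment costs at most one per prime. -/
theorem sum_primeDivisors_sq_le (P : Finset ℕ) (hP : ∀ p ∈ P, p.Prime) (N : ℕ) :
    ∑ n ∈ Icc 1 N, ((#{p ∈ P | p ∣ n} : ℝ) - ∑ p ∈ P, (1 / p : ℝ)) ^ 2 ≤
      N * (∑ p ∈ P, (1 / p : ℝ)) + 2 * (∑ p ∈ P, (1 / p : ℝ)) * #P := by
  set A : ℝ := ∑ p ∈ P, (1 / p : ℝ) with hA
  have hA0 : 0 ≤ A := sum_nonneg fun p _ => by positivity
  have hω : ∀ n, (#{p ∈ P | p ∣ n} : ℝ) = ∑ p ∈ P, if p ∣ n then (1 : ℝ) else 0 := by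
    intro n; rw [Finset.card_filter]; push_cast; rfl
  have hcount : ∀ d : ℕ, 0 < d → ∑ n ∈ Icc 1 N, (if d ∣ n then (1 : ℝ) else 0) =
      ((N / d : ℕ) : ℝ) := by
    intro d hd
    rw [← card_filter_dvd_Icc hd N, Finset.card_filter]; push_cast; rfl
  have h1 : (N : ℝ) * A - #P ≤ ∑ n ∈ Icc 1 N, (#{p ∈ P | p ∣ n} : ℝ) := by
    simp_rw [hω]
    rw [sum_comm, hA, mul_sum, Finset.card_eq_sum_ones]
    push_cast
    rw [← sum_sub_distrib]
    refine sum_le_sum fun p hp => ?_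
    rw [hcount p (hP p hp).pos]
    have := Nat.lt_floor_add_one ((N : ℝ) / p)
    rw [Nat.floor_div_natCast, Nat.floor_natCast] at this
    have e : (N : ℝ) * (1 / p) = N / p := by ring
    rw [e]; linarith
  have h2 : ∑ n ∈ Icc 1 N, (#{p ∈ P | p ∣ n} : ℝ) ^ 2 ≤ N * (A ^ 2 + A) := by
    have : ∀ n, (#{p ∈ P | p ∣ n} : ℝ) ^ 2 =
        ∑ p ∈ P, ∑ q ∈ P, (if p ∣ n then (1 : ℝ) else 0) * (if q ∣ n then (1 : ℝ) else 0) := by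
      intro n; rw [hω, sq, sum_mul_sum]
    simp_rw [this]
    rw [sum_comm]
    have hb : ∀ p ∈ P, ∑ n ∈ Icc 1 N, ∑ q ∈ P,
        (if p ∣ n then (1 : ℝ) else 0) * (if q ∣ n then (1 : ℝ) else 0) ≤
        N * ((1 / p) * A + 1 / p) := by
      intro p hp
      rw [sum_comm]
      have hb' : ∀ q ∈ P, ∑ n ∈ Icc 1 N,
        (if p ∣ n then (1 : ℝ) else 0) * (if q ∣ n then (1 : ℝ) else 0) ≤
          N * ((1 / p) * (1 / q)) + if q = p then N * (1 / p : ℝ) else 0 := by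
        intro q hq
        have hp0 : (0 : ℝ) < p := by exact_mod_cast (hP p hp).pos
        have hq0 : (0 : ℝ) < q := by exact_mod_cast (hP q hq).pos
        split_ifs with hpq
        · subst hpq
          have : ∀ n, (if q ∣ n then (1 : ℝ) else 0) * (if q ∣ n then (1 : ℝ) else 0) =
            if q ∣ n then (1 : ℝ) else 0 := by intro n; split_ifs <;> simp
          simp_rw [this]
          rw [hcount q (hP q hq).pos]
          have h3 : ((N / q : ℕ) : ℝ) ≤ N / q := Nat.cast_div_le
          have : (0 : ℝ) ≤ N * (1 / q * (1 / q)) := by positivity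
          have e : (N : ℝ) * (1 / q) = N / q := by ring
          rw [e]; linarith
        · have : ∀ n, (if p ∣ n then (1 : ℝ) else 0) * (if q ∣ n then (1 : ℝ) else 0) =
            if p * q ∣ n then (1 : ℝ) else 0 := by
            intro n
            have hc : p.Coprime q := (Nat.coprime_primes (hP p hp) (hP q hq)).2 (Ne.symm hpq)
            have hiff : p * q ∣ n ↔ p ∣ n ∧ q ∣ n :=
              ⟨fun h => ⟨(dvd_mul_right _ _).trans h, (dvd_mul_left _ _).trans h⟩,
                fun h => hc.mul_dvd_of_dvd_of_dvd h.1 h.2⟩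
            by_cases hpn : p ∣ n <;> by_cases hqn : q ∣ n <;> simp [hiff, hpn, hqn]
          simp_rw [this]
          rw [hcount (p * q) (Nat.mul_pos (hP p hp).pos (hP q hq).pos)]
          have h3 : ((N / (p * q) : ℕ) : ℝ) ≤ N / (p * q : ℕ) := Nat.cast_div_le
          push_cast at h3
          have e : (N : ℝ) * (1 / p * (1 / q)) = N / (p * q) := by field_simp
          rw [e]; linarith
      refine (sum_le_sum hb').trans ?_
      rw [sum_add_distrib, sum_ite_eq' P p, if_pos hp, ← mul_sum, ← mul_sum]
      exact le_of_eq (by rw [hA]; ring)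
    refine (sum_le_sum hb).trans (le_of_eq ?_)
    rw [← mul_sum, sum_add_distrib, ← sum_mul, ← hA]; ring
  have h3 : ∑ n ∈ Icc 1 N, ((#{p ∈ P | p ∣ n} : ℝ) - A) ^ 2 =
      ∑ n ∈ Icc 1 N, (#{p ∈ P | p ∣ n} : ℝ) ^ 2 - 2 * A * ∑ n ∈ Icc 1 N, (#{p ∈ P | p ∣ n} : ℝ)
        + N * A ^ 2 := by
    have : ∀ n, ((#{p ∈ P | p ∣ n} : ℝ) - A) ^ 2 =
      (#{p ∈ P | p ∣ n} : ℝ) ^ 2 - 2 * A * (#{p ∈ P | p ∣ n} : ℝ) + A ^ 2 := by intro n; ring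
    simp_rw [this]
    rw [sum_add_distrib, sum_sub_distrib, ← mul_sum]
    simp
  rw [h3]
  nlinarith [mul_le_mul_of_nonneg_left h1 hA0]

theorem norm_sum_sq_le_card_mul {ι : Type*} (s : Finset ι) (f : ι → ℂ) :
    ‖∑ i ∈ s, f i‖ ^ 2 ≤ #s * ∑ i ∈ s, ‖f i‖ ^ 2 :=
  (pow_le_pow_left₀ (norm_nonneg _) (norm_sum_le _ _) 2).trans (sq_sum_le_card_mul_sum_sq)

theorem norm_moebius_le (n : ℕ) : ‖(ArithmeticFunction.moebius n : ℂ)‖ ≤ 1 := by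
  rw [Complex.norm_intCast]
  exact_mod_cast ArithmeticFunction.abs_moebius_le_one (n := n)

theorem norm_moebius_prime_mul_add_le {p : ℕ} (hp : p.Prime) (m : ℕ) :
    ‖(ArithmeticFunction.moebius (p * m) : ℂ) + ArithmeticFunction.moebius m‖ ≤
      if p ∣ m then 1 else 0 := by
  split_ifs with h
  · have : ¬ Squarefree (p * m) := by
      intro hs
      obtain ⟨k, rfl⟩ := h
      exact hp.not_isUnit (hs p ⟨k, by ring⟩)
    rw [ArithmeticFunction.moebius_eq_zero_of_not_squarefree this]
    simpa using norm_moebius_le m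
  · rw [ArithmeticFunction.isMultiplicative_moebius.map_mul_of_coprime
      ((Nat.Prime.coprime_iff_not_dvd hp).2 h), ArithmeticFunction.moebius_apply_prime hp]
    simp

theorem sum_ite_mul_le_Icc {E : Type*} [AddCommMonoid E] (g : ℕ → E) {p : ℕ} (hp : 0 < p) (N : ℕ) :
    ∑ m ∈ Icc 1 N, (if p * m ≤ N then g m else 0) = ∑ m ∈ Icc 1 (N / p), g m := by
  rw [← sum_filter]
  congr 1
  ext m
  rw [mem_filter, mem_Icc, mem_Icc, Nat.le_div_iff_mul_le hp, mul_comm m p]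
  constructor
  · rintro ⟨⟨h1, -⟩, h2⟩; exact ⟨h1, h2⟩
  · rintro ⟨h1, h2⟩; exact ⟨⟨h1, (Nat.le_mul_of_pos_left m hp).trans h2⟩, h2⟩

/-- Both truncations hold exactly when `m ≤ N / max p q`, so this is a rescaled correlation average.
-/
theorem tendsto_truncated_correlation (F : ℕ → ℂ) {p q : ℕ} (hp : 0 < p)
    (H : Tendsto (fun N : ℕ => (1 / (N : ℂ)) * ∑ n ∈ Icc 1 N, F (p * n) * conj (F (q * n)))
      atTop (𝓝 0)) :
    Tendsto (fun N : ℕ => (1 / (N : ℝ)) * ‖∑ m ∈ Icc 1 N, (if p * m ≤ N then F (p * m) else 0) *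
      conj (if q * m ≤ N then F (q * m) else 0)‖) atTop (𝓝 0) := by
  have hr : 0 < max p q := lt_max_of_lt_left hp
  have e : ∀ N : ℕ, ∑ m ∈ Icc 1 N, (if p * m ≤ N then F (p * m) else 0) *
      conj (if q * m ≤ N then F (q * m) else 0) =
      ∑ m ∈ Icc 1 (N / max p q), F (p * m) * conj (F (q * m)) := by
    intro N
    rw [← sum_ite_mul_le_Icc _ hr]
    refine sum_congr rfl fun m _ => ?_
    have hmax : max p q * m ≤ N ↔ p * m ≤ N ∧ q * m ≤ N := by
      rw [max_mul_of_nonneg _ _ (Nat.zero_le m), max_le_iff]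
    by_cases h1 : p * m ≤ N <;> by_cases h2 : q * m ≤ N <;> simp [hmax, h1, h2]
  have hdiv : Tendsto (fun N : ℕ => N / max p q) atTop atTop := Nat.tendsto_div_const_atTop hr.ne'
  have := (H.comp hdiv).norm
  rw [norm_zero] at this
  refine squeeze_zero (fun N => by positivity) (fun N => ?_) this
  rw [e]
  simp only [Function.comp, norm_mul, norm_div, norm_one, Complex.norm_natCast]
  rcases Nat.eq_zero_or_pos (N / max p q) with h0 | h0
  · simp [h0]
  · refine mul_le_mul_of_nonneg_right ?_ (norm_nonneg _)
    exact one_div_le_one_div_of_le (by exact_mod_cast h0) (by exact_mod_cast Nat.div_le_self _ _)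

/-- Expanding the square, the diagonal gives at most `N ∑ 1/p`. The off-diagonal correlations are
`o(N)`, hence eventually below the same amount; this is the source of the factor 2. -/
theorem eventually_sum_norm_sq_dilates_le (F : ℕ → ℂ) (hF : ∀ n, ‖F n‖ ≤ 1) (P : Finset ℕ)
    (hP : ∀ p ∈ P, p.Prime) (hA : 0 < ∑ p ∈ P, (1 / p : ℝ))
    (H : ∀ p q : ℕ, p.Prime → q.Prime → p ≠ q →
      Tendsto (fun N : ℕ => (1 / (N : ℂ)) * ∑ n ∈ Icc 1 N, F (p * n) * conj (F (q * n)))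
        atTop (𝓝 0)) :
    ∀ᶠ N : ℕ in atTop, ∑ m ∈ Icc 1 N, ‖∑ p ∈ P, (if p * m ≤ N then F (p * m) else 0)‖ ^ 2 ≤
      N * (2 * ∑ p ∈ P, (1 / p : ℝ)) := by
  set A : ℝ := ∑ p ∈ P, (1 / p : ℝ) with hAdef
  let G : ℕ → ℕ → ℕ → ℂ := fun N p m => if p * m ≤ N then F (p * m) else 0
  have hoff : Tendsto (fun N : ℕ => ∑ p ∈ P, ∑ q ∈ P, if p = q then 0 else
      (1 / (N : ℝ)) * ‖∑ m ∈ Icc 1 N, G N p m * conj (G N q m)‖) atTop (𝓝 0) := by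
    rw [show (0 : ℝ) = ∑ p ∈ P, ∑ q ∈ P, 0 by simp]
    refine tendsto_finsetSum _ fun p hp => tendsto_finsetSum _ fun q hq => ?_
    by_cases hpq : p = q
    · simp [hpq]
    · simp only [hpq, if_false]
      exact tendsto_truncated_correlation F (hP p hp).pos (H p q (hP p hp) (hP q hq) hpq)
  filter_upwards [hoff.eventually_le_const hA, eventually_gt_atTop 0] with N hN hN0
  have hN0' : (0 : ℝ) < N := by exact_mod_cast hN0
  have key : ((∑ m ∈ Icc 1 N, ‖∑ p ∈ P, G N p m‖ ^ 2 : ℝ) : ℂ) =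
      ∑ p ∈ P, ∑ q ∈ P, ∑ m ∈ Icc 1 N, G N p m * conj (G N q m) := by
    push_cast
    calc _ = ∑ m ∈ Icc 1 N, ∑ p ∈ P, ∑ q ∈ P, G N p m * conj (G N q m) := by
          refine sum_congr rfl fun m _ => ?_
          rw [← Complex.mul_conj', map_sum, sum_mul_sum]
      _ = _ := by
          rw [sum_comm]
          refine sum_congr rfl fun p _ => ?_
          rw [sum_comm]
  have hG : ∀ p m, ‖G N p m‖ ≤ if p * m ≤ N then 1 else 0 := by
    intro p m
    by_cases h : p * m ≤ N <;> simp [G, h, hF]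
  have hdiag : ∀ p ∈ P, ‖∑ m ∈ Icc 1 N, G N p m * conj (G N p m)‖ ≤ N * (1 / p) := by
    intro p hp
    calc _ ≤ ∑ m ∈ Icc 1 N, ‖G N p m * conj (G N p m)‖ := norm_sum_le _ _
      _ ≤ ∑ m ∈ Icc 1 N, (if p * m ≤ N then (1 : ℝ) else 0) := by
          refine sum_le_sum fun m _ => ?_
          rw [norm_mul, RCLike.norm_conj]
          have := hG p m
          split_ifs at this ⊢ with h
          · exact mul_le_one₀ this (norm_nonneg _) this
          · have h0 : ‖G N p m‖ = 0 := le_antisymm this (norm_nonneg _)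
            simp [h0]
      _ = ((N / p : ℕ) : ℝ) := by
          rw [sum_ite_mul_le_Icc _ (hP p hp).pos]; simp
      _ ≤ N / p := Nat.cast_div_le
      _ = _ := by ring
  have h1 : ∑ m ∈ Icc 1 N, ‖∑ p ∈ P, G N p m‖ ^ 2 ≤
      ∑ p ∈ P, ∑ q ∈ P, ‖∑ m ∈ Icc 1 N, G N p m * conj (G N q m)‖ := by
    have hnn : 0 ≤ ∑ m ∈ Icc 1 N, ‖∑ p ∈ P, G N p m‖ ^ 2 := by positivity
    rw [← Complex.norm_of_nonneg hnn, key]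
    exact (norm_sum_le _ _).trans (sum_le_sum fun p _ => norm_sum_le _ _)
  refine h1.trans ?_
  have h2 : ∑ p ∈ P, ∑ q ∈ P, ‖∑ m ∈ Icc 1 N, G N p m * conj (G N q m)‖ ≤
      ∑ p ∈ P, ∑ q ∈ P, ((if p = q then N * (1 / p : ℝ) else 0) + N * (if p = q then 0 else
      (1 / (N : ℝ)) * ‖∑ m ∈ Icc 1 N, G N p m * conj (G N q m)‖)) := by
    refine sum_le_sum fun p hp => sum_le_sum fun q hq => ?_
    by_cases hpq : p = q
    · subst hpq; simpa using hdiag p hp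
    · simp only [hpq, if_false, zero_add]
      rw [← mul_assoc, mul_one_div_cancel hN0'.ne', one_mul]
  refine h2.trans ?_
  simp_rw [sum_add_distrib, ← mul_sum]
  have h3 : ∑ p ∈ P, ∑ q ∈ P, (if p = q then N * (1 / p : ℝ) else 0) = N * A := by
    rw [hAdef, mul_sum]
    refine sum_congr rfl fun p hp => ?_
    rw [sum_ite_eq, if_pos hp]
  rw [h3]
  nlinarith [mul_le_mul_of_nonneg_left hN hN0'.le]

/-- Write `n = pm` for each `p ∈ P` dividing `n`. Then `μ(pm) = -μ(m)` unless `p ∣ m`, and for each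
`p` at most `N/p²` values of `m` are exceptional. -/
theorem norm_sum_moebius_primes_add_le (F : ℕ → ℂ) (hF : ∀ n, ‖F n‖ ≤ 1) (P : Finset ℕ)
    (hP : ∀ p ∈ P, p.Prime) (N : ℕ) :
    ‖∑ n ∈ Icc 1 N, F n * (ArithmeticFunction.moebius n : ℂ) * (#{p ∈ P | p ∣ n} : ℂ) +
      ∑ m ∈ Icc 1 N, (ArithmeticFunction.moebius m : ℂ) *
        ∑ p ∈ P, (if p * m ≤ N then F (p * m) else 0)‖ ≤ N * ∑ p ∈ P, (1 / (p : ℝ) ^ 2) := by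
  have h1 : ∑ n ∈ Icc 1 N, F n * (ArithmeticFunction.moebius n : ℂ) * (#{p ∈ P | p ∣ n} : ℂ) =
      ∑ p ∈ P, ∑ m ∈ Icc 1 (N / p), F (p * m) * (ArithmeticFunction.moebius (p * m) : ℂ) := by
    have : ∀ n, F n * (ArithmeticFunction.moebius n : ℂ) * (#{p ∈ P | p ∣ n} : ℂ) =
      ∑ p ∈ P, if p ∣ n then F n * (ArithmeticFunction.moebius n : ℂ) else 0 := by
      intro n; rw [card_filter]; push_cast; rw [mul_sum]
      refine sum_congr rfl fun p _ => ?_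
      split_ifs <;> simp
    simp_rw [this]
    rw [sum_comm]
    refine sum_congr rfl fun p hp => ?_
    rw [← sum_filter, sum_filter_dvd_Icc _ (hP p hp).pos]
  have h2 : ∑ m ∈ Icc 1 N, (ArithmeticFunction.moebius m : ℂ) *
        ∑ p ∈ P, (if p * m ≤ N then F (p * m) else 0) =
      ∑ p ∈ P, ∑ m ∈ Icc 1 (N / p), F (p * m) * (ArithmeticFunction.moebius m : ℂ) := by
    simp_rw [mul_sum]
    rw [sum_comm]
    refine sum_congr rfl fun p hp => ?_
    rw [← sum_ite_mul_le_Icc _ (hP p hp).pos]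
    refine sum_congr rfl fun m _ => ?_
    split_ifs
    · ring
    · simp
  rw [h1, h2, ← sum_add_distrib, mul_sum]
  refine (norm_sum_le _ _).trans (sum_le_sum fun p hp => ?_)
  rw [← sum_add_distrib]
  calc _ ≤ ∑ m ∈ Icc 1 (N / p), (if p ∣ m then (1 : ℝ) else 0) := by
        refine norm_sum_le_of_le _ fun m _ => ?_
        rw [← mul_add, norm_mul]
        calc _ ≤ 1 * _ := mul_le_mul_of_nonneg_right (hF _) (norm_nonneg _)
          _ ≤ _ := by rw [one_mul]; exact norm_moebius_prime_mul_add_le (hP p hp) m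
    _ = ((N / p / p : ℕ) : ℝ) := by
        rw [← card_filter_dvd_Icc (hP p hp).pos (N / p), card_filter]; push_cast; rfl
    _ ≤ N * (1 / (p : ℝ) ^ 2) := by
        rw [Nat.div_div_eq_div_mul]
        refine Nat.cast_div_le.trans (le_of_eq ?_)
        push_cast; ring

theorem exists_primes_sum_inv_gt (C : ℝ) :
    ∃ P : Finset ℕ, (∀ p ∈ P, p.Prime) ∧ C < ∑ p ∈ P, (1 / p : ℝ) := by
  by_contra! hcon
  refine Nat.Primes.not_summable_one_div ?_
  refine summable_of_sum_le (c := C) (fun p => by positivity) fun u => ?_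
  have := hcon (u.image fun p : Nat.Primes => (p : ℕ)) (by
    intro p hp
    obtain ⟨q, -, rfl⟩ := mem_image.1 hp
    exact q.2)
  rwa [sum_image (g := fun p : Nat.Primes => (p : ℕ))
    fun p _ q _ h => Nat.Primes.coe_nat_injective h] at this

/-- The criterion of Kátai and Bourgain, Sarnak and Ziegler for the Möbius function. -/
theorem tendsto_moebius_of_correlations (F : ℕ → ℂ) (hF : ∀ n, ‖F n‖ ≤ 1)
    (H : ∀ p q : ℕ, p.Prime → q.Prime → p ≠ q →
      Tendsto (fun N : ℕ => (1 / (N : ℂ)) * ∑ n ∈ Icc 1 N, F (p * n) * conj (F (q * n)))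
        atTop (𝓝 0)) :
    Tendsto (fun N : ℕ => (1 / (N : ℂ)) * ∑ n ∈ Icc 1 N, F n * (ArithmeticFunction.moebius n : ℂ))
      atTop (𝓝 0) := by
  obtain ⟨B, hB0, hB⟩ : ∃ B : ℝ, 0 ≤ B ∧ ∀ P : Finset ℕ, ∑ p ∈ P, (1 / (p : ℝ) ^ 2) ≤ B := by
    have hs : Summable fun n : ℕ => 1 / (n : ℝ) ^ 2 := Real.summable_one_div_nat_pow.2 one_lt_two
    exact ⟨_, tsum_nonneg fun n => by positivity,
      fun P => hs.sum_le_tsum P fun n _ => by positivity⟩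
  rw [tendsto_zero_iff_norm_tendsto_zero, Metric.tendsto_atTop']
  intro ε hε
  -- Dividing the final bound by `A` leaves `B/A + 2√(2A)/A`; the two thresholds make each summand
  -- at most `ε/2`, the first strictly less.
  obtain ⟨P, hP, hPA⟩ := exists_primes_sum_inv_gt (max (2 * B / ε) (64 / ε ^ 2))
  set A : ℝ := ∑ p ∈ P, (1 / p : ℝ) with hAdef
  have hA1 : 2 * B / ε < A := (le_max_left _ _).trans_lt hPA
  have hA2 : 64 / ε ^ 2 < A := (le_max_right _ _).trans_lt hPA
  have hA : 0 < A := lt_trans (by positivity) hA2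
  obtain ⟨N₀, hN₀⟩ := eventually_atTop.1 (eventually_sum_norm_sq_dilates_le F hF P hP hA H)
  -- With `N > 2 #P`, the rounding term `2A #P` in the Turán–Kubilius bound is absorbed into `N A`.
  refine ⟨max N₀ (2 * #P), fun N hN => ?_⟩
  have hNP : 2 * (#P : ℝ) ≤ N := by exact_mod_cast (le_max_right _ _).trans hN.le
  have hN0 : (0 : ℝ) < N := by exact_mod_cast lt_of_le_of_lt (Nat.zero_le _) hN
  have hbil := hN₀ N ((le_max_left _ _).trans hN.le)
  have htk := sum_primeDivisors_sq_le P hP N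
  rw [← hAdef] at htk hbil
  have herr := norm_sum_moebius_primes_add_le F hF P hP N
  set S := ∑ n ∈ Icc 1 N, F n * (ArithmeticFunction.moebius n : ℂ) with hS
  set S₁ := ∑ n ∈ Icc 1 N, F n * (ArithmeticFunction.moebius n : ℂ) * (#{p ∈ P | p ∣ n} : ℂ)
  set S₂ := ∑ m ∈ Icc 1 N, (ArithmeticFunction.moebius m : ℂ) *
        ∑ p ∈ P, (if p * m ≤ N then F (p * m) else 0)
  set S₃ := ∑ n ∈ Icc 1 N, F n * (ArithmeticFunction.moebius n : ℂ) *
    (((#{p ∈ P | p ∣ n} : ℝ) - A : ℝ) : ℂ)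
  -- Replace the constant weight `A` by the number of divisors in `P`. The deviation `S₃` is small
  -- by Turán–Kubilius, and `S₁` is close to the bilinear sum `-S₂`.
  have hdecomp : (A : ℂ) * S = S₁ - S₃ := by
    rw [mul_sum, ← sum_sub_distrib]
    refine sum_congr rfl fun n _ => ?_
    push_cast; ring
  have hS2 : ‖S₂‖ ≤ N * √(2 * A) := by
    refine abs_le_of_sq_le_sq' ?_ (by positivity) |>.2
    rw [mul_pow, Real.sq_sqrt (by positivity)]
    refine (norm_sum_sq_le_card_mul _ _).trans ?_
    rw [Nat.card_Icc, Nat.add_sub_cancel, sq, mul_assoc]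
    refine mul_le_mul_of_nonneg_left (le_trans (sum_le_sum fun m _ => ?_) hbil) hN0.le
    rw [norm_mul]
    exact pow_le_pow_left₀ (by positivity)
      (mul_le_of_le_one_left (norm_nonneg _) (norm_moebius_le m)) 2
  have hS3 : ‖S₃‖ ≤ N * √(2 * A) := by
    refine abs_le_of_sq_le_sq' ?_ (by positivity) |>.2
    rw [mul_pow, Real.sq_sqrt (by positivity)]
    refine (norm_sum_sq_le_card_mul _ _).trans ?_
    rw [Nat.card_Icc, Nat.add_sub_cancel, sq, mul_assoc]
    refine mul_le_mul_of_nonneg_left ?_ hN0.le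
    calc _ ≤ ∑ n ∈ Icc 1 N, ((#{p ∈ P | p ∣ n} : ℝ) - A) ^ 2 := by
          refine sum_le_sum fun n _ => ?_
          rw [norm_mul, norm_mul, Complex.norm_real, Real.norm_eq_abs,
            ← sq_abs ((#{p ∈ P | p ∣ n} : ℝ) - A)]
          refine pow_le_pow_left₀ (by positivity) (mul_le_of_le_one_left (abs_nonneg _) ?_) 2
          exact mul_le_one₀ (hF n) (norm_nonneg _) (norm_moebius_le n)
      _ ≤ N * A + 2 * A * #P := htk
      _ ≤ N * (2 * A) := by nlinarith
  have hS1 : ‖S₁‖ ≤ N * B + N * √(2 * A) := by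
    calc ‖S₁‖ = ‖(S₁ + S₂) - S₂‖ := by ring_nf
      _ ≤ ‖S₁ + S₂‖ + ‖S₂‖ := norm_sub_le _ _
      _ ≤ _ := add_le_add (herr.trans (mul_le_mul_of_nonneg_left (hB P) hN0.le)) hS2
  have hAS : A * ‖S‖ ≤ N * (B + 2 * √(2 * A)) := by
    have : A * ‖S‖ = ‖S₁ - S₃‖ := by
      rw [← hdecomp, norm_mul, Complex.norm_real, Real.norm_of_nonneg hA.le]
    rw [this]
    refine (norm_sub_le _ _).trans ?_
    linarith
  have hfin : B + 2 * √(2 * A) < ε * A := by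
    have h1 : B < ε * A / 2 := by
      rw [div_lt_iff₀ hε] at hA1; linarith
    have h2 : 2 * √(2 * A) ≤ ε * A / 2 := by
      have : √(2 * A) ≤ ε * A / 4 := by
        refine Real.sqrt_le_iff.2 ⟨by positivity, ?_⟩
        rw [div_lt_iff₀ (by positivity)] at hA2
        nlinarith
      linarith
    linarith
  rw [dist_zero_right, norm_norm, norm_mul, norm_div, norm_one, Complex.norm_natCast,
    one_div_mul_eq_div, div_lt_iff₀ hN0]
  have : A * ‖S‖ < A * (ε * N) := hAS.trans_lt (by nlinarith)
  exact lt_of_mul_lt_mul_left this hA.le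

/-! ### A Tauberian theorem by Fourier analysis -/

theorem fourier_mul_exp_eq (φ : ℝ → ℂ) (y u : ℝ) :
    𝓕 (fun t => φ t * Complex.exp (2 * Real.pi * Complex.I * (t * y))) u = 𝓕 φ (u - y) := by
  rw [Real.fourier_real_eq_integral_exp_smul, Real.fourier_real_eq_integral_exp_smul]
  congr 1
  ext t
  simp only [smul_eq_mul]
  rw [mul_comm (φ t), ← mul_assoc, ← Complex.exp_add]
  congr 2
  push_cast; ring

theorem fourier_comp_div_eq (φ : ℝ → ℂ) {c : ℝ} (hc : 0 < c) (u : ℝ) :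
    𝓕 (fun t => φ (t / c)) u = c * 𝓕 φ (c * u) := by
  rw [Real.fourier_real_eq_integral_exp_smul, Real.fourier_real_eq_integral_exp_smul]
  have := Measure.integral_comp_div
    (fun t : ℝ => Complex.exp (↑(-2 * Real.pi * t * (c * u)) * Complex.I) • φ t) c
  rw [abs_of_pos hc, Complex.real_smul] at this
  rw [← this]
  congr 1
  ext t
  congr 3
  push_cast
  have : (c : ℂ) ≠ 0 := by exact_mod_cast hc.ne'
  field_simp

theorem integral_fourier_mul_eq_flip (f g : ℝ → ℂ) (hf : Integrable f) (hg : Integrable g) :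
    ∫ t, 𝓕 f t * g t = ∫ u, f u * 𝓕 g u := by
  simpa using! (VectorFourier.integral_fourierIntegral_smul_eq_flip (L := innerₗ ℝ)
    Real.continuous_fourierChar continuous_inner hf hg)

/-- For `δ > 0` the damped `m` is integrable and Fourier duality replaces it by `Φ δ`. Letting `δ →
0` turns the integral into a Fourier integral of `Φ 0 · φ`, continuous with compact support, and
Riemann–Lebesgue applies. -/
theorem tendsto_integral_mul_fourier_translate (m : ℝ → ℂ) (hm : Measurable m)
    (hm1 : ∀ u, ‖m u‖ ≤ 1) (hm0 : ∀ u < 0, m u = 0) (Φ : ℝ → ℝ → ℂ)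
    (hΦ : ContinuousOn (Function.uncurry Φ) (Set.Ici 0 ×ˢ Set.univ))
    (hmΦ : ∀ δ > 0, ∀ t, 𝓕 (fun u => m u * (Real.exp (-δ * u) : ℂ)) t = Φ δ t)
    (φ : ℝ → ℂ) (hφ : Continuous φ) (hφc : HasCompactSupport φ) (hK : Integrable (𝓕 φ)) :
    Tendsto (fun y => ∫ u, m u * 𝓕 φ (u - y)) atTop (𝓝 0) := by
  have hφi : Integrable φ := hφ.integrable_of_hasCompactSupport hφc
  have hΦ0 : Continuous (Φ 0) := by
    rw [← continuousOn_univ]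
    exact hΦ.comp (f := fun t => ((0 : ℝ), t)) (by fun_prop) (fun t _ => by simp)
  obtain ⟨C, hC⟩ : ∃ C, ∀ δ ∈ Set.Icc (0 : ℝ) 1, ∀ t ∈ tsupport φ, ‖Φ δ t‖ ≤ C := by
    obtain ⟨C, hC⟩ := (isCompact_Icc.prod hφc).exists_bound_of_continuousOn
      (hΦ.mono (Set.prod_mono Set.Icc_subset_Ici_self (Set.subset_univ _)) :
        ContinuousOn _ (Set.Icc (0 : ℝ) 1 ×ˢ tsupport φ))
    exact ⟨C, fun δ hδ t ht => hC (δ, t) ⟨hδ, ht⟩⟩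
  have hexp : ∀ y t : ℝ, ‖Complex.exp (2 * Real.pi * Complex.I * (t * y))‖ = 1 := by
    intro y t
    rw [show (2 * Real.pi * Complex.I * (t * y) : ℂ) = ((2 * Real.pi * t * y : ℝ) : ℂ) * Complex.I by
      push_cast; ring]
    exact Complex.norm_exp_ofReal_mul_I _
  have key : ∀ y, ∫ u, m u * 𝓕 φ (u - y) =
      ∫ t, Φ 0 t * (φ t * Complex.exp (2 * Real.pi * Complex.I * (t * y))) := by
    intro y
    have hψi : Integrable (fun t => φ t * Complex.exp (2 * Real.pi * Complex.I * (t * y))) :=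
      hφi.mul_bdd (c := 1) (by fun_prop) (Eventually.of_forall fun t => (hexp y t).le)
    have hKy : Integrable (fun u => 𝓕 φ (u - y)) := hK.comp_sub_right y
    have heq : ∀ δ > 0, ∫ u, m u * (Real.exp (-δ * u) : ℂ) * 𝓕 φ (u - y) =
        ∫ t, Φ δ t * (φ t * Complex.exp (2 * Real.pi * Complex.I * (t * y))) := by
      intro δ hδ
      have hgi : Integrable (fun u => m u * (Real.exp (-δ * u) : ℂ)) := by
        have h1 : IntegrableOn (fun u => m u * (Real.exp (-δ * u) : ℂ)) (Set.Ici 0) := by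
          rw [integrableOn_Ici_iff_integrableOn_Ioi]
          refine Integrable.bdd_mul (c := 1) ?_ hm.aestronglyMeasurable
            (Eventually.of_forall hm1)
          exact (integrableOn_exp_mul_Ioi (by linarith) 0).ofReal
        rw [← integrableOn_univ, ← Set.Iio_union_Ici (a := (0 : ℝ))]
        refine IntegrableOn.union ?_ h1
        exact integrableOn_zero.congr_fun (fun u hu => by simp [hm0 u hu]) measurableSet_Iio
      have := integral_fourier_mul_eq_flip _ _ hgi hψi
      simp_rw [fourier_mul_exp_eq, hmΦ δ hδ] at this
      exact this.symm
    have hL : Tendsto (fun δ : ℝ => ∫ u, m u * (Real.exp (-δ * u) : ℂ) * 𝓕 φ (u - y)) (𝓝[>] 0)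
        (𝓝 (∫ u, m u * 𝓕 φ (u - y))) := by
      refine tendsto_integral_filter_of_dominated_convergence (fun u => ‖𝓕 φ (u - y)‖) ?_ ?_
        hKy.norm ?_
      · exact Eventually.of_forall fun δ => ((hm.mul (by fun_prop)).aestronglyMeasurable).mul
          hKy.aestronglyMeasurable
      · filter_upwards [self_mem_nhdsWithin] with δ hδ
        refine Eventually.of_forall fun u => ?_
        rw [norm_mul]
        refine mul_le_of_le_one_left (norm_nonneg _) ?_
        rcases lt_or_ge u 0 with hu | hu
        · simp [hm0 u hu]
        · rw [norm_mul, Complex.norm_real, Real.norm_eq_abs, Real.abs_exp]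
          refine mul_le_one₀ (hm1 u) (Real.exp_pos _).le (Real.exp_le_one_iff.2 ?_)
          have : 0 ≤ δ * u := mul_nonneg (le_of_lt hδ) hu
          linarith
      · refine Eventually.of_forall fun u => ?_
        have : Continuous fun δ : ℝ => m u * (Real.exp (-δ * u) : ℂ) * 𝓕 φ (u - y) := by fun_prop
        have := (this.tendsto 0).mono_left (nhdsWithin_le_nhds (s := Set.Ioi 0))
        simpa using this
    have hR : Tendsto (fun δ : ℝ => ∫ t, Φ δ t * (φ t * Complex.exp (2 * Real.pi * Complex.I * (t * y))))
        (𝓝[>] 0) (𝓝 (∫ t, Φ 0 t * (φ t * Complex.exp (2 * Real.pi * Complex.I * (t * y))))) := by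
      refine tendsto_integral_filter_of_dominated_convergence (fun t => C * ‖φ t‖) ?_ ?_
        (hφi.norm.const_mul C) ?_
      · filter_upwards [self_mem_nhdsWithin] with δ hδ
        refine Continuous.aestronglyMeasurable (Continuous.mul ?_ (by fun_prop))
        rw [← continuousOn_univ]
        exact hΦ.comp (f := fun t => (δ, t)) (by fun_prop) (fun t _ => by simpa using le_of_lt hδ)
      · filter_upwards [Ioc_mem_nhdsGT (zero_lt_one' ℝ)] with δ hδ
        refine Eventually.of_forall fun t => ?_
        rw [norm_mul, norm_mul, hexp, mul_one]
        by_cases ht : t ∈ tsupport φ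
        · exact mul_le_mul_of_nonneg_right (hC δ ⟨hδ.1.le, hδ.2⟩ t ht) (norm_nonneg _)
        · simp [image_eq_zero_of_notMem_tsupport ht]
      · refine Eventually.of_forall fun t => Tendsto.mul_const _ ?_
        have h1 : ContinuousWithinAt (Function.uncurry Φ) (Set.Ici 0 ×ˢ Set.univ) (0, t) :=
          hΦ (0, t) (by simp)
        refine h1.tendsto.comp (f := fun δ : ℝ => (δ, t)) ?_
        refine tendsto_nhdsWithin_iff.2 ⟨?_, ?_⟩
        · have : Continuous fun δ : ℝ => (δ, t) := by fun_prop
          exact (this.tendsto 0).mono_left nhdsWithin_le_nhds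
        · filter_upwards [self_mem_nhdsWithin] with δ hδ
          simpa using le_of_lt hδ
    refine tendsto_nhds_unique hL (hR.congr' ?_)
    filter_upwards [self_mem_nhdsWithin] with δ hδ
    exact (heq δ hδ).symm
  simp_rw [key]
  have hRL := (Real.zero_at_infty_fourier (fun t => Φ 0 t * φ t)).comp
    (tendsto_neg_atTop_atBot.mono_right atBot_le_cocompact)
  refine hRL.congr fun y => ?_
  simp only [Function.comp]
  rw [Real.fourier_real_eq_integral_exp_smul]
  congr 1
  ext t
  rw [smul_eq_mul, mul_comm, mul_assoc]
  congr 3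
  push_cast; ring

/-- A Tauberian theorem of Wiener-Ikehara type for bounded slowly oscillating functions. -/
theorem tendsto_zero_of_fourierLaplace_continuous (m : ℝ → ℂ) (hm : Measurable m)
    (hm1 : ∀ u, ‖m u‖ ≤ 1) (hm0 : ∀ u < 0, m u = 0) (Φ : ℝ → ℝ → ℂ)
    (hΦ : ContinuousOn (Function.uncurry Φ) (Set.Ici 0 ×ˢ Set.univ))
    (hmΦ : ∀ δ > 0, ∀ t, 𝓕 (fun u => m u * (Real.exp (-δ * u) : ℂ)) t = Φ δ t)
    (ω r : ℝ → ℝ) (hω : Continuous ω) (hω0 : ω 0 = 0) (hr : Tendsto r atTop (𝓝 0))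
    (hslow : ∀ y w, ‖m (y + w) - m y‖ ≤ ω w + r y) :
    Tendsto m atTop (𝓝 0) := by
  obtain ⟨b⟩ : Nonempty (ContDiffBump (0 : ℝ)) := inferInstance
  let φ : ℝ → ℂ := fun t => (b t : ℂ)
  have hφs : ContDiff ℝ ((⊤ : ℕ∞) : WithTop ℕ∞) φ := Complex.ofRealCLM.contDiff.comp b.contDiff
  have hφc : HasCompactSupport φ := b.hasCompactSupport.comp_left (g := fun x : ℝ => (x : ℂ)) (by simp)
  have hφ : Continuous φ := hφs.continuous
  have hφi : Integrable φ := hφ.integrable_of_hasCompactSupport hφc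
  have hK : Integrable (𝓕 φ) :=
    (𝓕 (hφc.toSchwartzMap hφs)).integrable
  -- Fourier inversion at the origin, where the bump function equals 1.
  have hKint : ∫ v, 𝓕 φ v = 1 := by
    have := congrFun (hφ.fourierInv_fourier_eq hφi hK) 0
    rw [Real.fourierInv_eq] at this
    simpa [φ, b.one_of_mem_closedBall (Metric.mem_closedBall_self b.rIn_pos.le)] using this
  set K := 𝓕 φ with hKdef
  -- The bump `φ(t/c)` has transform `c K(cu)`, a kernel concentrated at scale `1/c`; a change of
  -- variables gives this form.
  have hconv : ∀ c > 0, Tendsto (fun y => ∫ v, m (y + v / c) * K v) atTop (𝓝 0) := by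
    intro c hc
    have hKc : 𝓕 (fun t => φ (t / c)) = fun u => (c : ℂ) * K (c * u) :=
      funext fun u => fourier_comp_div_eq φ hc u
    have h1 := tendsto_integral_mul_fourier_translate m hm hm1 hm0 Φ hΦ hmΦ (fun t => φ (t / c))
      (by fun_prop) (hφc.comp_homeomorph (Homeomorph.mulRight₀ c⁻¹ (inv_ne_zero hc.ne')))
      (by rw [hKc]; exact (hK.comp_mul_left' hc.ne').const_mul _)
    refine h1.congr fun y => ?_
    rw [hKc]
    have h2 := Measure.integral_comp_mul_left (fun v => m (y + v / c) * K v) c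
    have h3 := integral_sub_right_eq_self (fun u => m (y + c * u / c) * K (c * u)) y (μ := volume)
    rw [h2, abs_of_pos (inv_pos.2 hc), Complex.real_smul] at h3
    have hc' : (c : ℂ) ≠ 0 := by exact_mod_cast hc.ne'
    calc _ = (c : ℂ) * ∫ u, m (y + c * (u - y) / c) * K (c * (u - y)) := by
          rw [← integral_const_mul]
          congr 1; ext u
          rw [mul_div_cancel_left₀ _ hc.ne']
          simp only [add_sub_cancel]
          ring
      _ = _ := by
          rw [h3, ← mul_assoc]; push_cast; rw [mul_inv_cancel₀ hc', one_mul]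
  have hIK : 0 ≤ ∫ v, ‖K v‖ := integral_nonneg fun _ => norm_nonneg _
  -- The modulus `ω` may be unbounded while `K` is only integrable. Since `‖m‖ ≤ 1`, truncating at 2
  -- loses nothing and permits dominated convergence.
  have hω' : Tendsto (fun n : ℕ => ∫ v, min (|ω (v / ((n : ℝ) + 1))|) 2 * ‖K v‖) atTop (𝓝 0) := by
    rw [show (0 : ℝ) = ∫ _ : ℝ, (0 : ℝ) by simp]
    refine tendsto_integral_of_dominated_convergence (fun v => 2 * ‖K v‖) ?_
      (hK.norm.const_mul 2) ?_ ?_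
    · intro n
      exact (Continuous.aestronglyMeasurable (by fun_prop)).mul hK.norm.aestronglyMeasurable
    · intro n
      refine Eventually.of_forall fun v => ?_
      rw [norm_mul, norm_norm, Real.norm_of_nonneg (le_min (abs_nonneg _) (by norm_num))]
      exact mul_le_mul_of_nonneg_right (min_le_right _ _) (norm_nonneg _)
    · refine Eventually.of_forall fun v => ?_
      have h1 : Tendsto (fun n : ℕ => v / ((n : ℝ) + 1)) atTop (𝓝 0) :=
        tendsto_const_nhds.div_atTop (tendsto_natCast_atTop_atTop.atTop_add tendsto_const_nhds)
      have h2 : Continuous fun x => min |ω x| 2 * ‖K v‖ := by fun_prop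
      simpa [hω0, Function.comp_def] using (h2.tendsto 0).comp h1
  rw [tendsto_zero_iff_norm_tendsto_zero]
  refine tendsto_order.2 ⟨fun a ha => Eventually.of_forall fun y => ha.trans_le (norm_nonneg _),
    fun ε hε => ?_⟩
  obtain ⟨n, hn⟩ := (hω'.eventually_lt_const (show 0 < ε / 3 by positivity)).exists
  have hc : (0 : ℝ) < (n : ℝ) + 1 := by positivity
  have hr' : Tendsto (fun y => |r y| * ∫ v, ‖K v‖) atTop (𝓝 0) := by
    simpa using hr.abs.mul_const (∫ v, ‖K v‖)
  filter_upwards [(hconv _ hc).norm.eventually_lt_const (show ‖(0 : ℂ)‖ < ε / 3 by simp [hε]),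
    hr'.eventually_lt_const (show 0 < ε / 3 by positivity)] with y hy1 hy2
  have h_int : Integrable fun v => m (y + v / ((n : ℝ) + 1)) * K v :=
    hK.bdd_mul (c := 1) (hm.comp (by fun_prop)).aestronglyMeasurable
      (Eventually.of_forall fun v => hm1 _)
  have hdiff : ‖∫ v, (m (y + v / ((n : ℝ) + 1)) * K v - m y * K v)‖ ≤
      (∫ v, min (|ω (v / ((n : ℝ) + 1))|) 2 * ‖K v‖) + |r y| * ∫ v, ‖K v‖ := by
    have hi1 : Integrable fun v => min (|ω (v / ((n : ℝ) + 1))|) 2 * ‖K v‖ := by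
      refine hK.norm.bdd_mul (c := 2) (Continuous.aestronglyMeasurable (by fun_prop))
        (Eventually.of_forall fun v => ?_)
      rw [Real.norm_of_nonneg (le_min (abs_nonneg _) (by norm_num))]
      exact min_le_right _ _
    rw [← integral_const_mul, ← integral_add hi1 (hK.norm.const_mul _)]
    refine norm_integral_le_of_norm_le (hi1.add (hK.norm.const_mul _))
      (Eventually.of_forall fun v => ?_)
    rw [← sub_mul, norm_mul]
    change _ ≤ min (|ω (v / ((n : ℝ) + 1))|) 2 * ‖K v‖ + |r y| * ‖K v‖
    rw [← add_mul]
    refine mul_le_mul_of_nonneg_right ?_ (norm_nonneg _)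
    rw [← min_add_add_right]
    refine le_min ?_ ?_
    · exact (hslow y _).trans (add_le_add (le_abs_self _) (le_abs_self _))
    · have := norm_sub_le (m (y + v / ((n : ℝ) + 1))) (m y)
      linarith [hm1 (y + v / ((n : ℝ) + 1)), hm1 y, abs_nonneg (r y)]
  rw [integral_sub h_int (hK.const_mul _), integral_const_mul, hKint, mul_one] at hdiff
  have : ‖m y‖ ≤ ‖∫ v, m (y + v / ((n : ℝ) + 1)) * K v‖ +
      ‖(∫ v, m (y + v / ((n : ℝ) + 1)) * K v) - m y‖ := by
    rw [norm_sub_rev, add_comm]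
    exact norm_le_norm_sub_add _ _
  linarith

/-! ### The prime number theorem for the Möbius function -/

/-- The summatory function of the Möbius function. -/
noncomputable def mertens (x : ℝ) : ℂ := ∑ n ∈ Icc 1 ⌊x⌋₊, (ArithmeticFunction.moebius n : ℂ)

theorem norm_mertens_le {x : ℝ} (hx : 0 ≤ x) : ‖mertens x‖ ≤ x := by
  refine (norm_sum_le_of_le _ fun n _ => norm_moebius_le n).trans ?_
  simpa using Nat.floor_le hx

theorem norm_mertens_sub_le_of_le {x y : ℝ} (hx : 0 ≤ x) (hxy : x ≤ y) :
    ‖mertens y - mertens x‖ ≤ y - x + 1 := by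
  have hfl : ⌊x⌋₊ ≤ ⌊y⌋₊ := Nat.floor_mono hxy
  have hsub : Icc 1 ⌊x⌋₊ ⊆ Icc 1 ⌊y⌋₊ := Icc_subset_Icc_right hfl
  unfold mertens
  rw [← sum_sdiff hsub, add_sub_cancel_right]
  refine (norm_sum_le_of_le _ fun n _ => norm_moebius_le n).trans ?_
  rw [sum_const, nsmul_one, card_sdiff_of_subset hsub, Nat.card_Icc, Nat.card_Icc,
    Nat.add_sub_cancel, Nat.add_sub_cancel, Nat.cast_sub hfl]
  linarith [Nat.floor_le (hx.trans hxy), Nat.lt_floor_add_one x]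

theorem norm_mertens_sub_le {x y : ℝ} (hx : 0 ≤ x) (hy : 0 ≤ y) :
    ‖mertens y - mertens x‖ ≤ |y - x| + 1 := by
  rcases le_total x y with h | h
  · rw [abs_of_nonneg (by linarith)]; exact norm_mertens_sub_le_of_le hx h
  · rw [norm_sub_rev, abs_sub_comm, abs_of_nonneg (by linarith)]
    exact norm_mertens_sub_le_of_le hy h

theorem measurable_mertens : Measurable mertens :=
  (measurable_from_nat (f := fun k : ℕ => ∑ n ∈ Icc 1 k, (ArithmeticFunction.moebius n : ℂ))).comp
    Nat.measurable_floor

/-- The function `1 / (s ζ(s))`, continuously extended to the pole of `ζ`. -/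
noncomputable def invMulZeta : ℂ → ℂ := Function.update (fun s => 1 / (s * riemannZeta s)) 1 0

/-- Away from 1 this is the non-vanishing of `ζ` on `Re s ≥ 1`; at 1 the simple pole forces the
limit 0. -/
theorem continuousAt_invMulZeta {s : ℂ} (hs : 1 ≤ s.re) : ContinuousAt invMulZeta s := by
  rcases eq_or_ne s 1 with rfl | hs1
  · unfold invMulZeta
    rw [continuousAt_update_same]
    have h1 : Tendsto (fun s : ℂ => (s - 1) / (s * ((s - 1) * riemannZeta s))) (𝓝[≠] 1)
        (𝓝 ((1 - 1) / (1 * 1))) := by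
      have hid : Tendsto (fun s : ℂ => s) (𝓝[≠] 1) (𝓝 1) := tendsto_id.mono_left nhdsWithin_le_nhds
      exact (hid.sub_const 1).div (hid.mul riemannZeta_residue_one) (by simp)
    simp only [sub_self, zero_div] at h1
    refine h1.congr' ?_
    filter_upwards [self_mem_nhdsWithin] with s hs
    have : s - 1 ≠ 0 := sub_ne_zero.2 hs
    rw [mul_left_comm, div_mul_eq_div_div, div_self this]
  · have hs0 : s ≠ 0 := by rintro rfl; norm_num at hs
    unfold invMulZeta
    rw [continuousAt_update_of_ne hs1]
    exact continuousAt_const.div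
      (continuousAt_id.mul (differentiableAt_riemannZeta hs1).continuousAt)
      (mul_ne_zero hs0 (riemannZeta_ne_zero_of_one_le_re hs))

/-- Partial summation of the Dirichlet series of `μ`, which is `1/ζ(s)`. -/
theorem integral_mertens_eq {s : ℂ} (hs : 1 < s.re) :
    ∫ t in Set.Ioi (1 : ℝ), mertens t * (t : ℂ) ^ (-(s + 1)) = invMulZeta s := by
  have hs1 : s ≠ 1 := by rintro rfl; simp at hs
  have hs0 : s ≠ 0 := by rintro rfl; norm_num at hs
  have h1 := LSeries_eq_mul_integral' (fun n => (ArithmeticFunction.moebius n : ℂ)) (r := 1)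
    zero_le_one hs (by
      simp only [Real.rpow_one]
      refine Asymptotics.isBigO_of_le _ fun n => ?_
      rw [Real.norm_of_nonneg (sum_nonneg fun _ _ => norm_nonneg _), Real.norm_natCast]
      refine (sum_le_sum fun n _ => norm_moebius_le n).trans ?_
      simp)
  have h2 := ArithmeticFunction.LSeries_zeta_mul_Lseries_moebius hs
  rw [ArithmeticFunction.LSeries_zeta_eq_riemannZeta hs] at h2
  have hz : riemannZeta s ≠ 0 := left_ne_zero_of_mul_eq_one h2
  rw [h1] at h2
  unfold invMulZeta
  rw [Function.update_of_ne hs1]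
  change riemannZeta s * (s * ∫ t in Set.Ioi (1 : ℝ), mertens t * (t : ℂ) ^ (-(s + 1))) = 1 at h2
  rw [eq_div_iff (mul_ne_zero hs0 hz)]
  refine Eq.trans ?_ h2
  ring

/-- `M(eᵘ) e⁻ᵘ` -/
noncomputable def mertensExp (u : ℝ) : ℂ := mertens (Real.exp u) * (Real.exp (-u) : ℂ)

theorem mertensExp_eq_zero {u : ℝ} (hu : u < 0) : mertensExp u = 0 := by
  have : ⌊Real.exp u⌋₊ = 0 := Nat.floor_eq_zero.2 (Real.exp_lt_one_iff.2 hu)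
  simp [mertensExp, mertens, this]

theorem norm_mertensExp_le (u : ℝ) : ‖mertensExp u‖ ≤ 1 := by
  unfold mertensExp
  rw [norm_mul, Complex.norm_real, Real.norm_eq_abs, Real.abs_exp]
  calc _ ≤ Real.exp u * Real.exp (-u) :=
        mul_le_mul_of_nonneg_right (norm_mertens_le (Real.exp_pos _).le) (Real.exp_pos _).le
    _ = 1 := by rw [← Real.exp_add]; simp

/-- Slow oscillation. Changing the weight costs `|eʷ - 1|` because `|M(x)| ≤ x`; changing the
argument of `M` costs the length of the interval plus one, and that one becomes `e⁻ʸ`. -/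
theorem norm_mertensExp_sub_le (y w : ℝ) :
    ‖mertensExp (y + w) - mertensExp y‖ ≤ 2 * |Real.exp w - 1| + Real.exp (-y) := by
  have e : mertensExp (y + w) - mertensExp y =
      mertens (Real.exp (y + w)) * ((Real.exp (-(y + w)) - Real.exp (-y) : ℝ) : ℂ) +
      (mertens (Real.exp (y + w)) - mertens (Real.exp y)) * (Real.exp (-y) : ℂ) := by
    unfold mertensExp; push_cast; ring
  rw [e]
  refine (norm_add_le _ _).trans ?_
  rw [norm_mul, norm_mul, Complex.norm_real, Complex.norm_real, Real.norm_eq_abs, Real.norm_eq_abs,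
    Real.abs_exp]
  have h1 : ‖mertens (Real.exp (y + w))‖ * |Real.exp (-(y + w)) - Real.exp (-y)| ≤
      |Real.exp w - 1| := by
    refine (mul_le_mul_of_nonneg_right (norm_mertens_le (Real.exp_pos _).le) (abs_nonneg _)).trans ?_
    rw [← abs_of_pos (Real.exp_pos (y + w)), ← abs_mul, mul_sub,
      ← Real.exp_add, ← Real.exp_add, abs_sub_comm]
    simp
  have h2 : ‖mertens (Real.exp (y + w)) - mertens (Real.exp y)‖ * Real.exp (-y) ≤
      |Real.exp w - 1| + Real.exp (-y) := by
    refine (mul_le_mul_of_nonneg_right (norm_mertens_sub_le (Real.exp_pos _).le (Real.exp_pos _).le)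
      (Real.exp_pos _).le).trans ?_
    rw [add_mul, one_mul]
    refine add_le_add_left (le_of_eq ?_) _
    rw [← abs_of_pos (Real.exp_pos (-y)), ← abs_mul, sub_mul,
      ← Real.exp_add, ← Real.exp_add]
    simp
  linarith

/-- The substitution `x = eᵘ` turns the Fourier–Laplace transform into the Mellin integral of `M` at
`s = 1 + δ + 2πit`. -/
theorem fourier_mertensExp_eq {δ : ℝ} (hδ : 0 < δ) (t : ℝ) :
    𝓕 (fun u => mertensExp u * (Real.exp (-δ * u) : ℂ)) t =
      invMulZeta (1 + δ + 2 * Real.pi * t * Complex.I) := by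
  set s : ℂ := 1 + δ + 2 * Real.pi * t * Complex.I with hs
  have hre : s.re = 1 + δ := by simp [hs]
  rw [← integral_mertens_eq (by rw [hre]; linarith), Real.fourier_real_eq_integral_exp_smul]
  have h0 := integral_comp_exp_Ioi (fun t : ℝ => mertens t * (t : ℂ) ^ (-(s + 1))) 0
  rw [Real.exp_zero] at h0
  rw [← h0, ← setIntegral_eq_integral_of_forall_compl_eq_zero (s := Set.Ici (0 : ℝ)),
    integral_Ici_eq_integral_Ioi]
  · refine setIntegral_congr_fun measurableSet_Ioi fun u _ => ?_
    simp only [smul_eq_mul, Complex.real_smul]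
    have h2 : ((Real.exp u : ℝ) : ℂ) ^ (-(s + 1)) = Complex.exp (-(s + 1) * u) := by
      rw [Complex.cpow_def_of_ne_zero (by exact_mod_cast (Real.exp_pos u).ne'),
        ← Complex.ofReal_log (Real.exp_pos u).le, Real.log_exp, mul_comm]
    rw [h2]
    unfold mertensExp
    push_cast
    have h3 : Complex.exp (-2 * Real.pi * u * t * Complex.I) *
        (mertens (Real.exp u) * Complex.exp (-u) * Complex.exp (-δ * u)) =
        mertens (Real.exp u) * (Complex.exp (-2 * Real.pi * u * t * Complex.I) * Complex.exp (-u) *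
          Complex.exp (-δ * u)) := by ring
    have h4 : Complex.exp u * (mertens (Real.exp u) * Complex.exp (-(s + 1) * u)) =
        mertens (Real.exp u) * (Complex.exp u * Complex.exp (-(s + 1) * u)) := by ring
    rw [h3, h4, ← Complex.exp_add, ← Complex.exp_add, ← Complex.exp_add]
    congr 2
    rw [hs]; ring
  · intro u hu
    rw [mertensExp_eq_zero (by simpa using hu)]; simp

/-- The prime number theorem, in the form that the Möbius function has mean value zero. -/
theorem tendsto_average_moebius :
    Tendsto (fun N : ℕ => (1 / (N : ℂ)) * ∑ n ∈ Icc 1 N, (ArithmeticFunction.moebius n : ℂ))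
      atTop (𝓝 0) := by
  have h := tendsto_zero_of_fourierLaplace_continuous mertensExp
    ((measurable_mertens.comp Real.measurable_exp).mul (by fun_prop)) norm_mertensExp_le
    (fun u hu => mertensExp_eq_zero hu)
    (fun δ t => invMulZeta (1 + δ + 2 * Real.pi * t * Complex.I)) ?_
    (fun δ hδ t => fourier_mertensExp_eq hδ t)
    (fun w => 2 * |Real.exp w - 1|) (fun y => Real.exp (-y)) (by fun_prop) (by simp)
    Real.tendsto_exp_neg_atTop_nhds_zero norm_mertensExp_sub_le
  · have h2 := h.comp (Real.tendsto_log_atTop.comp tendsto_natCast_atTop_atTop)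
    refine h2.congr' ?_
    filter_upwards [eventually_gt_atTop 0] with N hN
    have hN' : (0 : ℝ) < N := by exact_mod_cast hN
    simp only [Function.comp, mertensExp, mertens]
    rw [Real.exp_neg, Real.exp_log hN', Nat.floor_natCast]
    push_cast; ring
  · intro p hp
    refine ContinuousAt.continuousWithinAt ?_
    have : ContinuousAt invMulZeta (1 + p.1 + 2 * Real.pi * p.2 * Complex.I) :=
      continuousAt_invMulZeta (by simpa using hp.1)
    exact ContinuousAt.comp (f := fun p : ℝ × ℝ => (1 + p.1 + 2 * Real.pi * p.2 * Complex.I : ℂ))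
      this (by fun_prop)

/-! ### Van der Corput's criterion and geometric averages -/

theorem norm_sum_range_shift_sub_le (w : ℕ → ℂ) (hw : ∀ n, ‖w n‖ ≤ 1) (N s : ℕ) :
    ‖∑ n ∈ range N, w (n + s) - ∑ n ∈ range N, w n‖ ≤ 2 * s := by
  have h1 : ∑ n ∈ range N, w (n + s) - ∑ n ∈ range N, w n =
      ∑ n ∈ range s, w (n + N) - ∑ n ∈ range s, w n := by
    have a := sum_range_add w s N
    have b := sum_range_add w N s
    rw [add_comm N s] at b
    simp_rw [add_comm s, add_comm N] at a b
    rw [a] at b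
    linear_combination b
  rw [h1]
  have h2 : ∀ f : ℕ → ℂ, (∀ n, ‖f n‖ ≤ 1) → ‖∑ n ∈ range s, f n‖ ≤ s := fun f hf =>
    (norm_sum_le_of_le _ fun n _ => hf n).trans (by simp)
  refine (norm_sub_le _ _).trans ?_
  linarith [h2 _ (fun n => hw (n + N)), h2 _ hw]

theorem tendsto_average_shift (w : ℕ → ℂ) (hw : ∀ n, ‖w n‖ ≤ 1) (s : ℕ) {l : ℂ}
    (h : Tendsto (fun N : ℕ => (1 / (N : ℂ)) * ∑ n ∈ range N, w n) atTop (𝓝 l)) :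
    Tendsto (fun N : ℕ => (1 / (N : ℂ)) * ∑ n ∈ range N, w (n + s)) atTop (𝓝 l) := by
  have h0 : Tendsto (fun N : ℕ => (1 / (N : ℂ)) *
      (∑ n ∈ range N, w (n + s) - ∑ n ∈ range N, w n)) atTop (𝓝 0) := by
    refine squeeze_zero_norm (a := fun N : ℕ => (2 * s : ℝ) / N) (fun N => ?_)
      (tendsto_const_div_atTop_nhds_zero_nat _)
    rw [norm_mul, norm_div, norm_one, Complex.norm_natCast, one_div_mul_eq_div]
    exact div_le_div_of_nonneg_right (norm_sum_range_shift_sub_le w hw N s) (Nat.cast_nonneg _)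
  have := h0.add h
  rw [zero_add] at this
  refine this.congr fun N => ?_
  ring

/-- The van der Corput criterion. -/
theorem tendsto_average_zero_of_correlations (v : ℕ → ℂ) (hv : ∀ n, ‖v n‖ ≤ 1) (c : ℕ → ℂ)
    (hc : ∀ k, Tendsto (fun N : ℕ => (1 / (N : ℂ)) * ∑ n ∈ range N, v (n + k) * conj (v n)) atTop
      (𝓝 (c k)))
    (hc0 : Tendsto c atTop (𝓝 0)) :
    Tendsto (fun N : ℕ => (1 / (N : ℂ)) * ∑ n ∈ range N, v n) atTop (𝓝 0) := by
  rw [tendsto_zero_iff_norm_tendsto_zero]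
  refine tendsto_order.2 ⟨fun a ha => Eventually.of_forall fun y => ha.trans_le (norm_nonneg _),
    fun ε hε => ?_⟩
  obtain ⟨M, hM⟩ : ∃ M, ∀ k ≥ M, ‖c k‖ < ε ^ 2 / 16 := by
    have := hc0.norm
    rw [norm_zero] at this
    exact eventually_atTop.1 (this.eventually_lt_const (by positivity))
  -- `L` is the number of shifted copies averaged: the diagonal carries a proportion `1/L < ε²/16`
  -- of the square, the size allowed to each correlation.
  obtain ⟨L, hL⟩ := exists_nat_gt (16 / ε ^ 2)
  have hL0 : (0 : ℝ) < L := lt_trans (by positivity) hL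
  have hvv : ∀ k n, ‖v (n + k) * conj (v n)‖ ≤ 1 := by
    intro k n
    rw [norm_mul, RCLike.norm_conj]
    exact mul_le_one₀ (hv _) (norm_nonneg _) (hv _)
  -- Shifts are multiples of `M + 1`, so any two distinct ones differ by at least `M` and the
  -- limiting correlation is below the threshold.
  have hD : ∀ i j, i ≠ j → ∀ᶠ N : ℕ in atTop,
      ‖(1 / (N : ℂ)) * ∑ n ∈ range N, v (n + i * (M + 1)) * conj (v (n + j * (M + 1)))‖ <
        ε ^ 2 / 16 := by
    have hgt : ∀ i j, j < i → ∀ᶠ N : ℕ in atTop,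
      ‖(1 / (N : ℂ)) * ∑ n ∈ range N, v (n + i * (M + 1)) * conj (v (n + j * (M + 1)))‖ <
        ε ^ 2 / 16 := by
      intro i j hij
      have h1 := tendsto_average_shift _ (hvv ((i - j) * (M + 1))) (j * (M + 1))
        (hc ((i - j) * (M + 1)))
      have h2 : M ≤ (i - j) * (M + 1) := by
        have : 1 ≤ i - j := by omega
        nlinarith
      have e : ∀ n, n + j * (M + 1) + (i - j) * (M + 1) = n + i * (M + 1) := by
        intro n
        rw [add_assoc, ← add_mul, Nat.add_sub_cancel' hij.le]
      simp_rw [e] at h1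
      exact h1.norm.eventually_lt_const (hM _ h2)
    intro i j hij
    rcases lt_or_gt_of_ne hij with h | h
    · filter_upwards [hgt j i h] with N hN
      rw [← RCLike.norm_conj] at hN
      simp only [map_mul, map_sum, map_div₀, map_one, Complex.conj_natCast, Complex.conj_conj] at hN
      simp_rw [mul_comm (v _)]
      exact hN
    · exact hgt i j h
  have hall : ∀ᶠ N : ℕ in atTop, ∀ i ∈ range L, ∀ j ∈ range L, i ≠ j →
      ‖(1 / (N : ℂ)) * ∑ n ∈ range N, v (n + i * (M + 1)) * conj (v (n + j * (M + 1)))‖ <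
        ε ^ 2 / 16 := by
    rw [eventually_all_finset]
    intro i _
    rw [eventually_all_finset]
    intro j _
    by_cases hij : i = j
    · exact Eventually.of_forall fun N h => absurd hij h
    · filter_upwards [hD i j hij] with N hN _ using hN
  have hsmall : ∀ᶠ N : ℕ in atTop, (2 * (L * (M + 1)) : ℝ) / N < ε / 2 :=
    (tendsto_const_div_atTop_nhds_zero_nat _).eventually_lt_const (by positivity)
  filter_upwards [hall, hsmall, eventually_gt_atTop 0] with N hN hN2 hNpos
  have hN0 : (0 : ℝ) < N := by exact_mod_cast hNpos
  set S := ∑ n ∈ range N, v n with hS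
  set W := ∑ n ∈ range N, ∑ i ∈ range L, v (n + i * (M + 1)) with hW
  have hdiff : ‖W - L * S‖ ≤ L * (2 * (L * (M + 1))) := by
    have : W - L * S = ∑ i ∈ range L, (∑ n ∈ range N, v (n + i * (M + 1)) - S) := by
      rw [sum_sub_distrib, hW, sum_comm]; simp
    rw [this]
    refine (norm_sum_le_of_le (f := fun i => ∑ n ∈ range N, v (n + i * (M + 1)) - S) _
      (n := fun _ => (2 * (L * (M + 1)) : ℝ)) fun i hi => ?_).trans (by simp)
    refine (norm_sum_range_shift_sub_le v hv N _).trans ?_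
    push_cast
    have : (i : ℝ) ≤ L := by exact_mod_cast (mem_range.1 hi).le
    gcongr
  have hWsq : ‖W‖ ^ 2 ≤ (N * L * (ε / 2)) ^ 2 / 2 := by
    have h1 : ((∑ n ∈ range N, ‖∑ i ∈ range L, v (n + i * (M + 1))‖ ^ 2 : ℝ) : ℂ) =
        ∑ i ∈ range L, ∑ j ∈ range L, ∑ n ∈ range N,
          v (n + i * (M + 1)) * conj (v (n + j * (M + 1))) := by
      push_cast
      calc _ = ∑ n ∈ range N, ∑ i ∈ range L, ∑ j ∈ range L,
            v (n + i * (M + 1)) * conj (v (n + j * (M + 1))) := by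
            refine sum_congr rfl fun m _ => ?_
            rw [← Complex.mul_conj', map_sum, sum_mul_sum]
        _ = _ := by
            rw [sum_comm]
            refine sum_congr rfl fun p _ => ?_
            rw [sum_comm]
    have h2 : ∑ n ∈ range N, ‖∑ i ∈ range L, v (n + i * (M + 1))‖ ^ 2 ≤
        ∑ i ∈ range L, ∑ j ∈ range L, ((if i = j then (N : ℝ) else 0) + N * (ε ^ 2 / 16)) := by
      have hnn : 0 ≤ ∑ n ∈ range N, ‖∑ i ∈ range L, v (n + i * (M + 1))‖ ^ 2 := by positivity
      rw [← Complex.norm_of_nonneg hnn, h1]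
      refine norm_sum_le_of_le _ fun i hi => norm_sum_le_of_le _ fun j hj => ?_
      by_cases hij : i = j
      · subst hij
        rw [if_pos rfl]
        have : ‖∑ n ∈ range N, v (n + i * (M + 1)) * conj (v (n + i * (M + 1)))‖ ≤ N := by
          refine (norm_sum_le_of_le _ fun n _ => hvv 0 (n + i * (M + 1))).trans (by simp)
        have h3 : 0 ≤ N * (ε ^ 2 / 16) := by positivity
        linarith
      · rw [if_neg hij, zero_add]
        have := (hN i hi j hj hij).le
        rw [norm_mul, norm_div, norm_one, Complex.norm_natCast, one_div_mul_eq_div,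
          div_le_iff₀ hN0] at this
        linarith
    have h3 : ∑ i ∈ range L, ∑ j ∈ range L, ((if i = j then (N : ℝ) else 0) + N * (ε ^ 2 / 16)) =
        L * N + L * (L * (N * (ε ^ 2 / 16))) := by
      simp_rw [sum_add_distrib]
      congr 1
      · calc _ = ∑ i ∈ range L, (N : ℝ) :=
            sum_congr rfl fun i hi => by rw [sum_ite_eq, if_pos hi]
          _ = _ := by simp
      · simp
    have h4 := norm_sum_sq_le_card_mul (range N) fun n => ∑ i ∈ range L, v (n + i * (M + 1))
    rw [card_range] at h4
    refine h4.trans ((mul_le_mul_of_nonneg_left (h2.trans h3.le) hN0.le).trans ?_)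
    have h5 : (L : ℝ) * 16 ≤ L * (L * ε ^ 2) := by
      rw [div_lt_iff₀ (by positivity)] at hL
      exact mul_le_mul_of_nonneg_left hL.le hL0.le
    nlinarith [mul_le_mul_of_nonneg_left h5 (mul_pos hN0 hN0).le]
  have hWn : ‖W‖ < N * L * (ε / 2) := by
    refine lt_of_pow_lt_pow_left₀ 2 (by positivity) (hWsq.trans_lt ?_)
    have : 0 < (N * L * (ε / 2)) ^ 2 := by positivity
    linarith
  rw [norm_mul, norm_div, norm_one, Complex.norm_natCast, one_div_mul_eq_div, div_lt_iff₀ hN0]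
  have hLS : L * ‖S‖ ≤ ‖W‖ + L * (2 * (L * (M + 1))) := by
    have h1 : ‖(L : ℂ) * S‖ = L * ‖S‖ := by rw [norm_mul, Complex.norm_natCast]
    rw [← h1]
    have := norm_sub_norm_le ((L : ℂ) * S) W
    rw [norm_sub_rev] at this
    linarith
  rw [div_lt_iff₀ hN0] at hN2
  have : L * ‖S‖ < L * (ε * N) := by nlinarith [mul_lt_mul_of_pos_left hN2 hL0]
  exact lt_of_mul_lt_mul_left this hL0.le

theorem norm_geom_sum_le {z : ℂ} (hz : ‖z‖ = 1) (hz1 : z ≠ 1) (N : ℕ) :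
    ‖∑ i ∈ range N, z ^ i‖ ≤ 2 / ‖z - 1‖ := by
  rw [geom_sum_eq hz1, norm_div]
  refine div_le_div_of_nonneg_right ?_ (norm_nonneg _)
  refine (norm_sub_le _ _).trans ?_
  rw [norm_pow, hz]; norm_num

theorem tendsto_average_pow {z : ℂ} (hz : ‖z‖ = 1) (hz1 : z ≠ 1) :
    Tendsto (fun N : ℕ => (1 / (N : ℂ)) * ∑ i ∈ range N, z ^ i) atTop (𝓝 0) := by
  refine squeeze_zero_norm (a := fun N : ℕ => (2 / ‖z - 1‖) / N) (fun N => ?_)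
    (tendsto_const_div_atTop_nhds_zero_nat _)
  rw [norm_mul, norm_div, norm_one, Complex.norm_natCast, one_div_mul_eq_div]
  exact div_le_div_of_nonneg_right (norm_geom_sum_le hz hz1 N) (Nat.cast_nonneg _)

theorem sum_Icc_one_eq_sum_range {E : Type*} [AddCommMonoid E] (g : ℕ → E) (N : ℕ) :
    ∑ n ∈ Icc 1 N, g n = ∑ n ∈ range N, g (n + 1) := by
  rw [range_eq_Ico, sum_Ico_add' g 0 N 1]
  rfl

/-! ### Fourier analysis and equidistribution on the torus -/

/-- The normalized Haar measure on the torus. -/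
noncomputable def torusHaar (d : Type*) [Fintype d] : Measure (UnitAddTorus d) :=
  Measure.pi fun _ => AddCircle.haarAddCircle

section torus

variable {d : Type*} [Fintype d]

instance : (torusHaar d).IsAddHaarMeasure := by unfold torusHaar; infer_instance

instance : IsProbabilityMeasure (torusHaar d) := by unfold torusHaar; infer_instance

theorem mFourier_apply_add (ξ : d → ℤ) (x y : UnitAddTorus d) :
    mFourier ξ (x + y) = mFourier ξ x * mFourier ξ y := by
  simp only [mFourier, ContinuousMap.coe_mk, Pi.add_apply, ← Finset.prod_mul_distrib]
  refine Finset.prod_congr rfl fun i _ => ?_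
  simp [fourier_apply, smul_add, AddCircle.toCircle_add]

theorem norm_mFourier_apply (ξ : d → ℤ) (x : UnitAddTorus d) : ‖mFourier ξ x‖ = 1 := by
  simp only [mFourier, fourier_apply, ContinuousMap.coe_mk, norm_prod, Circle.norm_coe,
    Finset.prod_const_one]

theorem mFourier_apply_zero (ξ : d → ℤ) : mFourier ξ (0 : UnitAddTorus d) = 1 := by
  simp [mFourier]

theorem mFourier_apply_nsmul (ξ : d → ℤ) (x : UnitAddTorus d) (n : ℕ) :
    mFourier ξ (n • x) = mFourier ξ x ^ n := by
  induction n with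
  | zero => rw [zero_smul, mFourier_apply_zero, pow_zero]
  | succ n ih => rw [succ_nsmul, mFourier_apply_add, ih, pow_succ]

theorem integrable_torus (g : C(UnitAddTorus d, ℂ)) : Integrable g (torusHaar d) :=
  g.continuous.integrable_of_hasCompactSupport (HasCompactSupport.of_compactSpace _)

theorem integral_mFourier_eq_zero {ξ : d → ℤ} {θ : UnitAddTorus d} (h : mFourier ξ θ ≠ 1) :
    ∫ x, mFourier ξ x ∂(torusHaar d) = 0 := by
  have h1 := integral_add_right_eq_self (μ := torusHaar d) (fun x => mFourier ξ x) θ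
  simp_rw [mFourier_apply_add, integral_mul_const] at h1
  have h2 : (∫ x, mFourier ξ x ∂(torusHaar d)) * (mFourier ξ θ - 1) = 0 := by
    rw [mul_sub, h1, mul_one, sub_self]
  exact (mul_eq_zero.1 h2).resolve_right (sub_ne_zero.2 h)

/-- The Weyl equidistribution theorem on the torus. -/
theorem tendsto_average_torus {θ : UnitAddTorus d} (hθ : ∀ ξ : d → ℤ, ξ ≠ 0 → mFourier ξ θ ≠ 1)
    (g : C(UnitAddTorus d, ℂ)) (x : UnitAddTorus d) :
    Tendsto (fun N : ℕ => (1 / (N : ℂ)) * ∑ n ∈ range N, g (x + n • θ)) atTop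
      (𝓝 (∫ w, g w ∂(torusHaar d))) := by
  have hspan : ∀ g ∈ Submodule.span ℂ (Set.range (mFourier (d := d))),
      Tendsto (fun N : ℕ => (1 / (N : ℂ)) * ∑ n ∈ range N, g (x + n • θ)) atTop
      (𝓝 (∫ w, g w ∂(torusHaar d))) := by
    intro g hg
    induction hg using Submodule.span_induction with
    | mem g hg =>
      obtain ⟨ξ, rfl⟩ := hg
      by_cases hξ : ξ = 0
      · subst hξ
        simp only [UnitAddTorus.mFourier_zero, ContinuousMap.one_apply, sum_const, card_range,
          nsmul_one, integral_const, probReal_univ, one_smul]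
        refine tendsto_const_nhds.congr' ?_
        filter_upwards [eventually_gt_atTop 0] with N hN
        have : (N : ℂ) ≠ 0 := by exact_mod_cast hN.ne'
        field_simp
      · rw [integral_mFourier_eq_zero (hθ ξ hξ)]
        have := (tendsto_average_pow (norm_mFourier_apply ξ θ) (hθ ξ hξ)).const_mul (mFourier ξ x)
        rw [mul_zero] at this
        refine this.congr fun N => ?_
        simp_rw [mFourier_apply_add, mFourier_apply_nsmul, ← mul_sum]
        ring
    | zero => simp
    | add f g _ _ hf hg =>
      simp only [ContinuousMap.add_apply, sum_add_distrib, mul_add]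
      rw [integral_add (integrable_torus f) (integrable_torus g)]
      exact hf.add hg
    | smul c f _ hf =>
      simp only [ContinuousMap.smul_apply, ← smul_sum, integral_smul]
      refine (hf.const_smul c).congr fun N => ?_
      simp only [smul_eq_mul]; ring
  rw [Metric.tendsto_atTop]
  intro ε hε
  have hdense : g ∈ closure (Submodule.span ℂ (Set.range (mFourier (d := d))) : Set _) := by
    rw [← Submodule.topologicalClosure_coe, UnitAddTorus.span_mFourier_closure_eq_top]
    trivial
  obtain ⟨f, hf, hgf⟩ := Metric.mem_closure_iff.1 hdense (ε / 3) (by positivity)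
  obtain ⟨N₀, hN₀⟩ := Metric.tendsto_atTop.1 (hspan f hf) (ε / 3) (by positivity)
  refine ⟨N₀, fun N hN => ?_⟩
  rw [dist_eq_norm] at hgf
  have hpt : ∀ w, ‖g w - f w‖ ≤ ‖g - f‖ := fun w => (g - f).norm_coe_le_norm w
  have h1 : dist ((1 / (N : ℂ)) * ∑ n ∈ range N, g (x + n • θ))
      ((1 / (N : ℂ)) * ∑ n ∈ range N, f (x + n • θ)) ≤ ‖g - f‖ := by
    rw [dist_eq_norm, ← mul_sub, ← sum_sub_distrib, norm_mul, norm_div, norm_one,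
      Complex.norm_natCast, one_div_mul_eq_div]
    refine div_le_of_le_mul₀ (Nat.cast_nonneg _) (norm_nonneg _) ?_
    refine (norm_sum_le_of_le _ fun n _ => hpt _).trans ?_
    simp [mul_comm]
  have h2 : dist (∫ w, f w ∂(torusHaar d)) (∫ w, g w ∂(torusHaar d)) ≤ ‖g - f‖ := by
    rw [dist_comm, dist_eq_norm, ← integral_sub (integrable_torus g) (integrable_torus f)]
    refine (norm_integral_le_of_norm_le_const (Eventually.of_forall hpt)).trans ?_
    simp
  have h3 := hN₀ N hN
  have h4 := dist_triangle4 ((1 / (N : ℂ)) * ∑ n ∈ range N, g (x + n • θ))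
    ((1 / (N : ℂ)) * ∑ n ∈ range N, f (x + n • θ)) (∫ w, f w ∂(torusHaar d))
    (∫ w, g w ∂(torusHaar d))
  linarith

theorem hasSum_sq_mFourierCoeff_continuous (g : C(UnitAddTorus d, ℂ)) :
    HasSum (fun ξ : d → ℤ => ‖mFourierCoeff g ξ‖ ^ 2) (∫ w, ‖g w‖ ^ 2 ∂(torusHaar d)) := by
  have h := UnitAddTorus.hasSum_sq_mFourierCoeff (g.toLp 2 (torusHaar d) ℂ)
  have h1 : ∀ ξ, mFourierCoeff (g.toLp 2 (torusHaar d) ℂ) ξ = mFourierCoeff g ξ :=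
    UnitAddTorus.mFourierCoeff_toLp g
  have h2 : (fun ξ : d → ℤ => ‖mFourierCoeff g ξ‖ ^ 2) =
      fun ξ => ‖mFourierCoeff (g.toLp 2 (torusHaar d) ℂ) ξ‖ ^ 2 := funext fun ξ => by rw [h1]
  have h3 : ∫ w, ‖g w‖ ^ 2 ∂(torusHaar d) =
      ∫ w, ‖(g.toLp 2 (torusHaar d) ℂ) w‖ ^ 2 ∂(torusHaar d) := by
    refine integral_congr_ae ?_
    filter_upwards [ContinuousMap.coeFn_toLp (p := 2) (torusHaar d) (𝕜 := ℂ) g] with w hw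
    rw [hw]
  rw [h2, h3]
  exact h

theorem mFourierCoeff_eq (g : UnitAddTorus d → ℂ) (ξ : d → ℤ) :
    mFourierCoeff g ξ = ∫ w, mFourier (-ξ) w * g w ∂(torusHaar d) := rfl

theorem mFourierCoeff_translate (g : C(UnitAddTorus d, ℂ)) (a : UnitAddTorus d) (ξ : d → ℤ) :
    mFourierCoeff (fun w => g (w + a)) ξ = mFourier ξ a * mFourierCoeff g ξ := by
  rw [mFourierCoeff_eq, mFourierCoeff_eq,
    ← integral_add_right_eq_self (fun w => mFourier (-ξ) w * g w) a, ← integral_const_mul]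
  congr 1
  ext w
  rw [mFourier_apply_add, UnitAddTorus.mFourier_neg (x := a)]
  have : mFourier ξ a * conj (mFourier ξ a) = 1 := by
    rw [Complex.mul_conj', norm_mFourier_apply]; simp
  linear_combination (- mFourier (-ξ) w * g (w + a)) * this

end torus

/-- Parseval, with translation acting on Fourier coefficients as multiplication by a character. -/
theorem hasSum_sq_translate_combination {ι : Type*} {d : Type*} [Fintype d] (s : Finset ι)
    (a b : ι → UnitAddTorus d) (g : C(UnitAddTorus d, ℂ)) :
    HasSum (fun ξ : d → ℤ => ‖(∑ i ∈ s, (mFourier ξ (a i) - mFourier ξ (b i))) *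
      mFourierCoeff g ξ‖ ^ 2)
      (∫ w, ‖∑ i ∈ s, (g (w + a i) - g (w + b i))‖ ^ 2 ∂(torusHaar d)) := by
  have h := hasSum_sq_mFourierCoeff_continuous
    (⟨fun w => ∑ i ∈ s, (g (w + a i) - g (w + b i)), by fun_prop⟩ : C(UnitAddTorus d, ℂ))
  simp only [ContinuousMap.coe_mk] at h
  convert h using 4 with ξ
  have hi : ∀ c : UnitAddTorus d, Integrable (fun w => mFourier (-ξ) w * g (w + c))
      (torusHaar d) := fun c =>
    integrable_torus (⟨fun w => mFourier (-ξ) w * g (w + c), by fun_prop⟩ : C(UnitAddTorus d, ℂ))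
  rw [mFourierCoeff_eq fun w => ∑ i ∈ s, (g (w + a i) - g (w + b i))]
  have e : ∀ w, mFourier (-ξ) w * ∑ i ∈ s, (g (w + a i) - g (w + b i)) =
      ∑ i ∈ s, (mFourier (-ξ) w * g (w + a i) - mFourier (-ξ) w * g (w + b i)) := by
    intro w; rw [mul_sum]; exact sum_congr rfl fun i _ => mul_sub _ _ _
  simp_rw [e]
  have hsum := integral_finsetSum s (μ := torusHaar d)
    (f := fun i w => mFourier (-ξ) w * g (w + a i) - mFourier (-ξ) w * g (w + b i))
    fun i _ => (hi (a i)).sub (hi (b i))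
  rw [hsum, sum_mul]
  refine sum_congr rfl fun i _ => ?_
  rw [integral_sub (hi _) (hi _), ← mFourierCoeff_eq (fun w => g (w + a i)),
    ← mFourierCoeff_eq (fun w => g (w + b i)), mFourierCoeff_translate, mFourierCoeff_translate,
    sub_mul]

/-! ### Vertical increments along a minimal rotation -/

/-- The image in the two-dimensional torus of a point of the plane. -/
def toTorus₂ (x y : ℝ) : UnitAddTorus (Fin 2) := ![(x : UnitAddCircle), (y : UnitAddCircle)]

theorem toTorus₂_add (x y x' y' : ℝ) :
    toTorus₂ (x + x') (y + y') = toTorus₂ x y + toTorus₂ x' y' := by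
  ext i; fin_cases i <;> simp [toTorus₂]

theorem toTorus₂_zero : toTorus₂ 0 0 = 0 := by
  ext i; fin_cases i <;> simp [toTorus₂]

theorem toTorus₂_nsmul (n : ℕ) (x y : ℝ) : toTorus₂ (n * x) (n * y) = n • toTorus₂ x y := by
  ext i; fin_cases i <;> simp [toTorus₂, ← nsmul_eq_mul]

theorem toTorus₂_surjective (w : UnitAddTorus (Fin 2)) : ∃ x y : ℝ, toTorus₂ x y = w := by
  obtain ⟨x, hx⟩ := QuotientAddGroup.mk_surjective (w 0)
  obtain ⟨y, hy⟩ := QuotientAddGroup.mk_surjective (w 1)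
  refine ⟨x, y, ?_⟩
  ext i; fin_cases i
  · exact hx
  · exact hy

theorem mFourier_toTorus₂ (ξ : Fin 2 → ℤ) (x y : ℝ) :
    mFourier ξ (toTorus₂ x y) = Complex.exp (2 * Real.pi * Complex.I * (ξ 0 * x + ξ 1 * y)) := by
  simp only [mFourier, ContinuousMap.coe_mk, Fin.prod_univ_two, toTorus₂, Matrix.cons_val_zero,
    Matrix.cons_val_one]
  rw [fourier_coe_apply, fourier_coe_apply, ← Complex.exp_add]
  congr 1
  push_cast; ring

theorem mFourier_toTorus₂_zero_left (ξ : Fin 2 → ℤ) (r : ℝ) :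
    mFourier ξ (toTorus₂ 0 r) = Complex.exp (Complex.I * ((2 * Real.pi * ξ 1 * r : ℝ) : ℂ)) := by
  rw [mFourier_toTorus₂]; congr 1; push_cast; ring

theorem norm_mFourier_vertical_sub_one_le (ξ : Fin 2 → ℤ) (r : ℝ) :
    ‖mFourier ξ (toTorus₂ 0 r) - 1‖ ≤ 2 * Real.pi * |(ξ 1 : ℝ)| * |r| := by
  rw [mFourier_toTorus₂_zero_left]
  refine Real.norm_exp_I_mul_ofReal_sub_one_le.trans (le_of_eq ?_)
  rw [Real.norm_eq_abs, abs_mul, abs_mul, abs_of_pos Real.two_pi_pos]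

theorem tendsto_mFourier_vertical_slope (ξ : Fin 2 → ℤ) :
    Tendsto (fun r : ℝ => ‖mFourier ξ (toTorus₂ 0 r) - 1‖ / r) (𝓝[>] 0)
      (𝓝 (2 * Real.pi * |(ξ 1 : ℝ)|)) := by
  have h1 : HasDerivAt (fun r : ℝ => mFourier ξ (toTorus₂ 0 r))
      (Complex.I * (2 * Real.pi * ξ 1)) 0 := by
    simp_rw [mFourier_toTorus₂_zero_left]
    have h2 : HasDerivAt (fun r : ℝ => (2 * Real.pi * ξ 1 * r : ℝ)) (2 * Real.pi * ξ 1) 0 := by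
      simpa using (hasDerivAt_id (0 : ℝ)).const_mul (2 * Real.pi * (ξ 1 : ℝ))
    have h3 := (h2.ofReal_comp.const_mul Complex.I).cexp
    simpa using h3
  have h4 := (hasDerivAt_iff_tendsto_slope_zero.1 h1).norm.mono_left
    (nhdsWithin_mono (0 : ℝ) (fun r (hr : 0 < r) => hr.ne'))
  have e : ‖Complex.I * (2 * Real.pi * ξ 1)‖ = 2 * Real.pi * |(ξ 1 : ℝ)| := by
    simp [abs_of_pos Real.pi_pos]
  rw [e] at h4
  refine h4.congr' ?_
  filter_upwards [self_mem_nhdsWithin] with r hr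
  have hr' : (0 : ℝ) < r := hr
  rw [zero_add, toTorus₂_zero, mFourier_apply_zero, norm_smul, norm_inv,
    Real.norm_of_nonneg hr'.le, inv_mul_eq_div]

/-- Parseval bounds the coefficients of every difference quotient by `K²` in square sum. Letting `r
→ 0⁺` in finite partial sums keeps the bound, so no differentiability of `g` is needed. -/
theorem summable_vertical_sq_mFourierCoeff (g : C(UnitAddTorus (Fin 2), ℂ)) {K r₀ : ℝ}
    (hr₀ : 0 < r₀) (hg : ∀ r, 0 < r → r < r₀ → ∀ w, ‖g (w + toTorus₂ 0 r) - g w‖ ≤ K * r) :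
    Summable fun ξ : Fin 2 → ℤ => (2 * Real.pi * |(ξ 1 : ℝ)|) ^ 2 * ‖mFourierCoeff g ξ‖ ^ 2 := by
  refine summable_of_sum_le (c := K ^ 2) (fun ξ => by positivity) fun S => ?_
  have hlim : Tendsto (fun r : ℝ => ∑ ξ ∈ S, (‖mFourier ξ (toTorus₂ 0 r) - 1‖ / r) ^ 2 *
      ‖mFourierCoeff g ξ‖ ^ 2) (𝓝[>] 0)
      (𝓝 (∑ ξ ∈ S, (2 * Real.pi * |(ξ 1 : ℝ)|) ^ 2 * ‖mFourierCoeff g ξ‖ ^ 2)) :=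
    tendsto_finsetSum _ fun ξ _ => ((tendsto_mFourier_vertical_slope ξ).pow 2).mul_const _
  refine le_of_tendsto hlim ?_
  filter_upwards [Ioo_mem_nhdsGT hr₀] with r hr
  have h1 := hasSum_sq_translate_combination {()} (fun _ => toTorus₂ 0 r) (fun _ => 0) g
  simp only [sum_singleton, add_zero, mFourier_apply_zero] at h1
  have h2 : ∫ w, ‖g (w + toTorus₂ 0 r) - g w‖ ^ 2 ∂(torusHaar (Fin 2)) ≤ (K * r) ^ 2 := by
    have : ‖∫ w, ‖g (w + toTorus₂ 0 r) - g w‖ ^ 2 ∂(torusHaar (Fin 2))‖ ≤ (K * r) ^ 2 *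
        (torusHaar (Fin 2)).real Set.univ := by
      refine norm_integral_le_of_norm_le_const (Eventually.of_forall fun w => ?_)
      rw [Real.norm_of_nonneg (by positivity)]
      exact pow_le_pow_left₀ (norm_nonneg _) (hg r hr.1 hr.2 w) 2
    rw [probReal_univ, mul_one] at this
    exact (le_abs_self _).trans this
  have h3 := (sum_le_hasSum S (fun ξ _ => by positivity) h1).trans h2
  have hr2 : 0 < r ^ 2 := pow_pos hr.1 2
  have h4 : ∑ ξ ∈ S, (‖mFourier ξ (toTorus₂ 0 r) - 1‖ / r) ^ 2 * ‖mFourierCoeff g ξ‖ ^ 2 =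
      (∑ ξ ∈ S, ‖(mFourier ξ (toTorus₂ 0 r) - 1) * mFourierCoeff g ξ‖ ^ 2) / r ^ 2 := by
    rw [sum_div]
    refine sum_congr rfl fun ξ _ => ?_
    rw [norm_mul, mul_pow, div_pow]; ring
  rw [h4, div_le_iff₀ hr2, ← mul_pow]
  exact h3

/-- The ergodic sums, over `p k` steps of a minimal rotation, of the increments of size `s / k` of
a function that is Lipschitz in one direction tend to zero in `L²`. -/
theorem tendsto_integral_sq_sum_increments {θ : UnitAddTorus (Fin 2)}
    (hθ : ∀ ξ : Fin 2 → ℤ, ξ ≠ 0 → mFourier ξ θ ≠ 1)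
    (g : C(UnitAddTorus (Fin 2), ℂ)) {K r₀ : ℝ}
    (hr₀ : 0 < r₀) (hg : ∀ r, 0 < r → r < r₀ → ∀ w, ‖g (w + toTorus₂ 0 r) - g w‖ ≤ K * r)
    (p : ℕ) (s : ℝ) :
    Tendsto (fun k : ℕ => ∫ w, ‖∑ i ∈ range (p * k), (g (w + (i • θ + toTorus₂ 0 (s / k))) -
      g (w + i • θ))‖ ^ 2 ∂(torusHaar (Fin 2))) atTop (𝓝 0) := by
  have hsum := summable_vertical_sq_mFourierCoeff g hr₀ hg
  have h_int : ∀ k : ℕ, ∫ w, ‖∑ i ∈ range (p * k), (g (w + (i • θ + toTorus₂ 0 (s / k))) -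
      g (w + i • θ))‖ ^ 2 ∂(torusHaar (Fin 2)) = ∑' ξ : Fin 2 → ℤ,
      (‖mFourier ξ (toTorus₂ 0 (s / k)) - 1‖ * ‖∑ i ∈ range (p * k), mFourier ξ θ ^ i‖) ^ 2 *
        ‖mFourierCoeff g ξ‖ ^ 2 := by
    intro k
    rw [← (hasSum_sq_translate_combination (range (p * k))
      (fun i => i • θ + toTorus₂ 0 (s / k)) (fun i => i • θ) g).tsum_eq]
    refine tsum_congr fun ξ => ?_
    rw [norm_mul, mul_pow, ← norm_mul]
    congr 3
    rw [mul_sum]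
    refine sum_congr rfl fun i _ => ?_
    rw [mFourier_apply_add, mFourier_apply_nsmul]; ring
  simp_rw [h_int]
  suffices h : Tendsto _ atTop (𝓝 (∑' _ : Fin 2 → ℤ, (0 : ℝ))) by rwa [tsum_zero] at h
  -- For fixed `ξ` with `ξ 1 ≠ 0` the geometric sum is bounded and the increment factor is `O(1/k)`;
  -- if `ξ 1 = 0` the term vanishes. For domination, the trivial bound `pk` on the geometric sum
  -- cancels the `1/k`.
  refine tendsto_tsum_of_dominated_convergence (hsum.mul_left ((|s| * p) ^ 2)) ?_ ?_
  · intro ξ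
    by_cases hξ : ξ 1 = 0
    · have : ∀ r : ℝ, mFourier ξ (toTorus₂ 0 r) - 1 = 0 := by
        intro r; rw [mFourier_toTorus₂_zero_left, hξ]; simp
      simp [this]
    · have hξ0 : ξ ≠ 0 := by rintro rfl; simp at hξ
      have hn := norm_mFourier_apply ξ θ
      have h1 := norm_geom_sum_le hn (hθ ξ hξ0)
      have h2 : Tendsto (fun k : ℕ => ((2 * Real.pi * |(ξ 1 : ℝ)| * |s / k|) *
          (2 / ‖mFourier ξ θ - 1‖)) ^ 2 * ‖mFourierCoeff g ξ‖ ^ 2) atTop (𝓝 0) := by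
        have h3 := (tendsto_const_div_atTop_nhds_zero_nat s).abs
        rw [abs_zero] at h3
        simpa using (((h3.const_mul (2 * Real.pi * |(ξ 1 : ℝ)|)).mul_const
          (2 / ‖mFourier ξ θ - 1‖)).pow 2).mul_const (‖mFourierCoeff g ξ‖ ^ 2)
      refine squeeze_zero (fun k => by positivity) (fun k => ?_) h2
      have h4 := norm_mFourier_vertical_sub_one_le ξ (s / k)
      have h5 := h1 (p * k)
      exact mul_le_mul_of_nonneg_right (pow_le_pow_left₀ (by positivity)
        (mul_le_mul h4 h5 (norm_nonneg _) (by positivity)) 2) (by positivity)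
  · refine Eventually.of_forall fun k ξ => ?_
    have h1 : ‖∑ i ∈ range (p * k), mFourier ξ θ ^ i‖ ≤ p * k := by
      refine (norm_sum_le_of_le (n := fun _ => 1) _ fun i _ => ?_).trans (by simp)
      rw [norm_pow, norm_mFourier_apply, one_pow]
    have h2 := norm_mFourier_vertical_sub_one_le ξ (s / k)
    have h3 : ‖mFourier ξ (toTorus₂ 0 (s / k)) - 1‖ * ‖∑ i ∈ range (p * k), mFourier ξ θ ^ i‖ ≤
        |s| * p * (2 * Real.pi * |(ξ 1 : ℝ)|) := by
      calc _ ≤ (2 * Real.pi * |(ξ 1 : ℝ)| * |s / k|) * (p * k) :=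
            mul_le_mul h2 h1 (norm_nonneg _) (by positivity)
        _ = (|s / k| * k) * p * (2 * Real.pi * |(ξ 1 : ℝ)|) := by ring
        _ ≤ |s| * p * (2 * Real.pi * |(ξ 1 : ℝ)|) := by
            refine mul_le_mul_of_nonneg_right (mul_le_mul_of_nonneg_right ?_ (Nat.cast_nonneg p))
              (by positivity)
            rw [abs_div, Nat.abs_cast]
            -- For `k = 0` the quotient `s / k` is 0 by convention and the bound still holds.
            rcases eq_or_ne (k : ℝ) 0 with hk | hk
            · simp [hk]
            · rw [div_mul_cancel₀ _ hk]
    rw [Real.norm_of_nonneg (by positivity)]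
    calc _ ≤ (|s| * p * (2 * Real.pi * |(ξ 1 : ℝ)|)) ^ 2 * ‖mFourierCoeff g ξ‖ ^ 2 :=
          mul_le_mul_of_nonneg_right (pow_le_pow_left₀ (by positivity) h3 2) (by positivity)
      _ = _ := by ring

/-! ### Descent to the torus and real lifts of circle-valued maps -/

/-- `t ↦ exp(2πit)` -/
noncomputable def expi (t : ℝ) : ℂ := Complex.exp (2 * Real.pi * Complex.I * t)

theorem expi_add (s t : ℝ) : expi (s + t) = expi s * expi t := by
  simp only [expi, ← Complex.exp_add]; congr 1; push_cast; ring

theorem expi_zero : expi 0 = 1 := by simp [expi]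

theorem expi_eq (t : ℝ) : expi t = Complex.exp (Complex.I * ((2 * Real.pi * t : ℝ) : ℂ)) := by
  unfold expi; congr 1; push_cast; ring

theorem norm_expi (t : ℝ) : ‖expi t‖ = 1 := by
  rw [expi_eq, mul_comm]; exact Complex.norm_exp_ofReal_mul_I _

theorem expi_int (n : ℤ) : expi n = 1 := by
  unfold expi
  rw [Complex.exp_eq_one_iff]
  exact ⟨n, by push_cast; ring⟩

theorem expi_half : expi (1 / 2) = -1 := by
  unfold expi
  rw [← Complex.exp_pi_mul_I]
  congr 1; push_cast; ring

theorem expi_mul_conj (t : ℝ) : expi t * conj (expi t) = 1 := by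
  rw [Complex.mul_conj', norm_expi]; simp

theorem conj_expi (t : ℝ) : conj (expi t) = expi (-t) := by
  have h : expi t * expi (-t) = 1 := by rw [← expi_add, add_neg_cancel, expi_zero]
  have h0 : expi t ≠ 0 := left_ne_zero_of_mul_eq_one h
  exact mul_left_cancel₀ h0 ((expi_mul_conj t).trans h.symm)

theorem norm_expi_sub_one_le (t : ℝ) : ‖expi t - 1‖ ≤ 2 * Real.pi * |t| := by
  rw [expi_eq]
  refine Real.norm_exp_I_mul_ofReal_sub_one_le.trans (le_of_eq ?_)
  rw [Real.norm_eq_abs, abs_mul, abs_of_pos Real.two_pi_pos]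

theorem continuous_expi : Continuous expi := by unfold expi; fun_prop

theorem continuous_toTorus₂ : Continuous fun p : ℝ × ℝ => toTorus₂ p.1 p.2 := by
  refine continuous_pi fun i => ?_
  fin_cases i
  · exact (AddCircle.continuous_mk' 1).comp continuous_fst
  · exact (AddCircle.continuous_mk' 1).comp continuous_snd

theorem isOpenMap_toTorus₂ : IsOpenMap fun p : ℝ × ℝ => toTorus₂ p.1 p.2 := by
  have h1 : IsOpenMap (Prod.map ((↑) : ℝ → UnitAddCircle) ((↑) : ℝ → UnitAddCircle)) :=
    (QuotientAddGroup.isOpenMap_coe).prodMap (QuotientAddGroup.isOpenMap_coe)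
  exact (Homeomorph.finTwoArrow (X := UnitAddCircle)).symm.isOpenMap.comp h1

theorem isQuotientMap_toTorus₂ : IsQuotientMap fun p : ℝ × ℝ => toTorus₂ p.1 p.2 :=
  isOpenMap_toTorus₂.isQuotientMap continuous_toTorus₂ fun w => by
    obtain ⟨x, y, h⟩ := toTorus₂_surjective w
    exact ⟨(x, y), h⟩

theorem periodic_int {E : Type*} {f : ℝ → E} (h : ∀ x, f (x + 1) = f x) (x : ℝ) (n : ℤ) :
    f (x + n) = f x := by
  have := (show Function.Periodic f 1 from h).int_mul n x
  simpa using this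

theorem exists_int_add_of_coe_eq {x x' : ℝ} (h : (x : UnitAddCircle) = x') :
    ∃ a : ℤ, x' = x + a := by
  obtain ⟨a, ha⟩ := (AddCircle.coe_eq_zero_iff (1 : ℝ) (x := x' - x)).1 (by simp [h])
  exact ⟨a, by simp at ha; linarith⟩

/-- A continuous function on the plane with period lattice `ℤ²` descends to the torus. -/
theorem exists_torus_descent {E : Type*} [TopologicalSpace E] (Φ : ℝ → ℝ → E)
    (hΦ : Continuous fun p : ℝ × ℝ => Φ p.1 p.2) (h1 : ∀ x y, Φ (x + 1) y = Φ x y)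
    (h2 : ∀ x y, Φ x (y + 1) = Φ x y) :
    ∃ φ : C(UnitAddTorus (Fin 2), E), ∀ x y, φ (toTorus₂ x y) = Φ x y := by
  let q : C(ℝ × ℝ, UnitAddTorus (Fin 2)) := ⟨_, continuous_toTorus₂⟩
  have hq : IsQuotientMap q := isQuotientMap_toTorus₂
  have hfac : Function.FactorsThrough (⟨_, hΦ⟩ : C(ℝ × ℝ, E)) q := by
    rintro ⟨x, y⟩ ⟨x', y'⟩ h
    have hx : (x : UnitAddCircle) = x' := congrFun h 0
    have hy : (y : UnitAddCircle) = y' := congrFun h 1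
    obtain ⟨a, rfl⟩ := exists_int_add_of_coe_eq hx
    obtain ⟨b, rfl⟩ := exists_int_add_of_coe_eq hy
    change Φ x y = Φ (x + a) (y + b)
    rw [periodic_int (f := fun x => Φ x (y + b)) (fun x => h1 x _) x a,
      periodic_int (f := Φ x) (h2 x) y b]
  refine ⟨hq.lift _ hfac, fun x y => ?_⟩
  exact congrArg (fun f : C(ℝ × ℝ, E) => f (x, y)) (hq.lift_comp _ hfac)

theorem exists_int_eq_of_continuous {f : ℝ × ℝ → ℝ} (hf : Continuous f)
    (h_int : ∀ p, ∃ n : ℤ, f p = n) : ∃ n : ℤ, ∀ p, f p = n := by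
  obtain ⟨n, hn⟩ := h_int 0
  refine ⟨n, fun p => ?_⟩
  obtain ⟨k, hk⟩ := h_int p
  by_contra hne
  have hkn : k ≠ n := fun h => hne (by rw [hk, h])
  have hmid : ∀ a b : ℤ, ∀ p q, f p = a → f q = b → a < b → False := by
    intro a b p q hp hq hab
    have hab' : (a : ℝ) + 1 ≤ b := by exact_mod_cast hab
    obtain ⟨r, hr⟩ := mem_range_of_exists_le_of_exists_ge hf (c := (a : ℝ) + 1 / 2)
      ⟨p, by linarith⟩ ⟨q, by linarith⟩
    obtain ⟨l, hl⟩ := h_int r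
    rw [hl] at hr
    have h1 : (a : ℝ) < l := by linarith
    have h2 : (l : ℝ) < a + 1 := by linarith
    have h1' : a < l := by exact_mod_cast h1
    have h2' : l < a + 1 := by exact_mod_cast h2
    omega
  rcases lt_or_gt_of_ne hkn with h | h
  · exact hmid _ _ _ _ hk hn h
  · exact hmid _ _ _ _ hn hk h

/-- A continuous map from the torus to the circle is the sum of an integral linear form and of
the projection of a real continuous function. -/
theorem exists_torus_lift (h : UnitAddCircle × UnitAddCircle → UnitAddCircle)
    (hh : Continuous h) :
    ∃ (A B : ℤ) (h₀ : C(UnitAddTorus (Fin 2), ℝ)), ∀ x y : ℝ,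
      ((h₀ (toTorus₂ x y) + A * x + B * y : ℝ) : UnitAddCircle) = h (x, y) := by
  let f : C(ℝ × ℝ, UnitAddCircle) := ⟨fun p => h ((p.1 : UnitAddCircle), (p.2 : UnitAddCircle)),
    hh.comp (((AddCircle.continuous_mk' 1).comp continuous_fst).prodMk
      ((AddCircle.continuous_mk' 1).comp continuous_snd))⟩
  obtain ⟨e₀, he₀⟩ := QuotientAddGroup.mk_surjective (f 0)
  -- The plane is simply connected, so the pull-back of `h` lifts through the covering `ℝ → ℝ/ℤ`.
  obtain ⟨H, ⟨-, hH⟩, -⟩ := (AddCircle.isCoveringMap_coe (1 : ℝ)).existsUnique_continuousMap_lifts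
    f 0 e₀ he₀
  have hH' : ∀ x y : ℝ, ((H (x, y) : ℝ) : UnitAddCircle) = h (x, y) := fun x y => congrFun hH (x, y)
  -- The increment of the lift over a period is continuous and integer-valued, hence constant; these
  -- constants are the degrees of `h` in the two directions.
  obtain ⟨A, hA⟩ := exists_int_eq_of_continuous
    (f := fun p : ℝ × ℝ => H (p.1 + 1, p.2) - H (p.1, p.2)) (by fun_prop) (by
      rintro ⟨x, y⟩
      obtain ⟨a, ha⟩ := exists_int_add_of_coe_eq (x := H (x, y)) (x' := H (x + 1, y))
        (by rw [hH', hH']; simp)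
      exact ⟨a, by simp [ha]⟩)
  obtain ⟨B, hB⟩ := exists_int_eq_of_continuous
    (f := fun p : ℝ × ℝ => H (p.1, p.2 + 1) - H (p.1, p.2)) (by fun_prop) (by
      rintro ⟨x, y⟩
      obtain ⟨a, ha⟩ := exists_int_add_of_coe_eq (x := H (x, y)) (x' := H (x, y + 1))
        (by rw [hH', hH']; simp)
      exact ⟨a, by simp [ha]⟩)
  obtain ⟨h₀, hh₀⟩ := exists_torus_descent (fun x y : ℝ => H (x, y) - A * x - B * y) (by fun_prop)
    (fun x y => by have := hA (x, y); dsimp only at this; linarith)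
    (fun x y => by have := hB (x, y); dsimp only at this; linarith)
  refine ⟨A, B, h₀, fun x y => ?_⟩
  rw [hh₀, ← hH']
  congr 1; ring

theorem norm_coe_unitAddCircle_le (r : ℝ) : ‖(r : UnitAddCircle)‖ ≤ |r| := by
  rcases le_total |r| (|(1 : ℝ)| / 2) with h | h
  · exact ((AddCircle.norm_coe_eq_abs_iff (1 : ℝ) one_ne_zero).2 h).le
  · exact (AddCircle.norm_le_half_period (1 : ℝ) one_ne_zero).trans h

theorem norm_toTorus₂_zero_left_le (r : ℝ) : ‖toTorus₂ 0 r‖ ≤ |r| := by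
  refine (pi_norm_le_iff_of_nonneg (abs_nonneg r)).2 fun i => ?_
  fin_cases i
  · simp [toTorus₂]
  · simp only [toTorus₂]
    exact norm_coe_unitAddCircle_le r

/-- The circle metric sees an increment only modulo 1. For small `r`, uniform continuity of `h₀`
keeps the total increment `D + Br` within `1/2`, where the circle norm is the absolute value;
removing the linear part adds `|B|` to the constant. -/
theorem exists_vertical_lipschitz {K : NNReal}
    {h : UnitAddCircle × UnitAddCircle → UnitAddCircle} (hh : LipschitzWith K h) {A B : ℤ}
    {h₀ : C(UnitAddTorus (Fin 2), ℝ)}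
    (hh₀ : ∀ x y : ℝ, ((h₀ (toTorus₂ x y) + A * x + B * y : ℝ) : UnitAddCircle) = h (x, y)) :
    ∃ r₀ > 0, ∀ r, 0 < r → r < r₀ → ∀ w, |h₀ (w + toTorus₂ 0 r) - h₀ w| ≤ (K + |(B : ℝ)|) * r := by
  have hunif := CompactSpace.uniformContinuous_of_continuous h₀.continuous
  obtain ⟨δ, hδ, hδ'⟩ := Metric.uniformContinuous_iff.1 hunif (1 / 4) (by norm_num)
  refine ⟨min δ (1 / (4 * (|(B : ℝ)| + 1))), by positivity, fun r hr hr' w => ?_⟩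
  obtain ⟨x, y, rfl⟩ := toTorus₂_surjective w
  have h1 : |h₀ (toTorus₂ x y + toTorus₂ 0 r) - h₀ (toTorus₂ x y)| < 1 / 4 := by
    rw [← Real.dist_eq]
    refine hδ' ?_
    rw [dist_eq_norm, add_sub_cancel_left]
    refine (norm_toTorus₂_zero_left_le r).trans_lt ?_
    rw [abs_of_pos hr]
    exact hr'.trans_le (min_le_left _ _)
  rw [← toTorus₂_add, add_zero] at h1 ⊢
  have h2 : |(B : ℝ)| * r < 1 / 4 := by
    have h3 := hr'.trans_le (min_le_right _ _)
    rw [lt_div_iff₀ (by positivity)] at h3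
    nlinarith [abs_nonneg (B : ℝ)]
  have hBr : |B * r| = |(B : ℝ)| * r := by rw [abs_mul, abs_of_pos hr]
  set D := h₀ (toTorus₂ x (y + r)) - h₀ (toTorus₂ x y) with hD
  have h3 : |D + B * r| ≤ 1 / 2 := (abs_add_le _ _).trans (by rw [hBr]; linarith)
  have h4 : ‖((D + B * r : ℝ) : UnitAddCircle)‖ = |D + B * r| :=
    (AddCircle.norm_coe_eq_abs_iff (1 : ℝ) one_ne_zero).2 (by simpa using h3)
  have h5 : ((D + B * r : ℝ) : UnitAddCircle) =
      h (x, ((y + r : ℝ) : UnitAddCircle)) - h (x, y) := by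
    rw [← hh₀, ← hh₀, ← AddCircle.coe_sub]
    congr 1
    rw [hD]; ring
  have h6 : |D + B * r| ≤ K * r := by
    rw [← h4, h5, ← dist_eq_norm]
    refine (hh.dist_le_mul _ _).trans (mul_le_mul_of_nonneg_left ?_ K.2)
    rw [Prod.dist_eq, dist_self, dist_eq_norm, AddCircle.coe_add, add_sub_cancel_left]
    refine max_le hr.le ?_
    exact (norm_coe_unitAddCircle_le r).trans (abs_of_pos hr).le
  have h7 : |D| ≤ |D + B * r| + |B * r| := by
    have := abs_sub (D + B * r) (B * r)
    rwa [add_sub_cancel_right] at this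
  rw [add_mul, ← hBr]
  linarith

theorem mFourier_toTorus₂_ne_one {α β : ℝ} (hαβ : LinearIndependent ℚ ![α, β, 1])
    (ξ : Fin 2 → ℤ) (hξ : ξ ≠ 0) : mFourier ξ (toTorus₂ α β) ≠ 1 := by
  rw [mFourier_toTorus₂]
  intro h
  obtain ⟨n, hn⟩ := Complex.exp_eq_one_iff.1 h
  have h1 : (ξ 0 * α + ξ 1 * β : ℝ) = n := by
    have h2 : (2 * Real.pi * Complex.I : ℂ) ≠ 0 := Complex.two_pi_I_ne_zero
    have h3 : (ξ 0 * α + ξ 1 * β : ℂ) = n := mul_left_cancel₀ h2 (by rw [hn]; ring)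
    exact_mod_cast h3
  have h4 := Fintype.linearIndependent_iff.1 hαβ ![(ξ 0 : ℚ), (ξ 1 : ℚ), -(n : ℚ)] (by
    simp only [Fin.sum_univ_three, Matrix.cons_val_zero, Matrix.cons_val_one, Matrix.cons_val_two,
      Matrix.head_cons, Matrix.tail_cons, Rat.smul_def]
    push_cast
    simp
    linarith)
  apply hξ
  ext i
  fin_cases i
  · simpa using h4 0
  · simpa using h4 1

/-- Multiplication by `p` is a surjective continuous endomorphism, so it preserves normalized Haar
measure, as does translation. -/
theorem integral_torus_affine (g : C(UnitAddTorus (Fin 2), ℝ)) {p : ℕ} (hp : 0 < p)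
    (w₀ : UnitAddTorus (Fin 2)) :
    ∫ w, g (w₀ + p • w) ∂(torusHaar (Fin 2)) = ∫ w, g w ∂(torusHaar (Fin 2)) := by
  have hmp : MeasurePreserving (nsmulAddMonoidHom (α := UnitAddTorus (Fin 2)) p)
      (torusHaar (Fin 2)) (torusHaar (Fin 2)) := by
    refine AddMonoidHom.measurePreserving (continuous_nsmul p) ?_ rfl
    intro w
    obtain ⟨x, y, rfl⟩ := toTorus₂_surjective w
    refine ⟨toTorus₂ (x / p) (y / p), ?_⟩
    have hp' : (p : ℝ) ≠ 0 := by exact_mod_cast hp.ne'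
    simp only [nsmulAddMonoidHom_apply]
    rw [← toTorus₂_nsmul, mul_div_cancel₀ _ hp', mul_div_cancel₀ _ hp']
  have h1 := integral_map (μ := torusHaar (Fin 2)) hmp.measurable.aemeasurable
    (f := fun w => g (w₀ + w)) (by
      exact Continuous.aestronglyMeasurable (by fun_prop))
  rw [hmp.map_eq, integral_add_left_eq_self (fun w => g w) w₀] at h1
  exact h1.symm

/-! ### Heisenberg-periodic functions -/

/-- Continuous functions on `ℝ³` that are invariant under right multiplication by integer points
for the Heisenberg product. -/
structure HeisPeriodic (F : ℝ → ℝ → ℝ → ℂ) : Prop where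
  cont : Continuous fun p : ℝ × ℝ × ℝ => F p.1 p.2.1 p.2.2
  right : ∀ x y z : ℝ, ∀ a b c : ℤ, F (x + a) (y + b) (z + c + (x * b - a * y)) = F x y z

/-- Cocompactness of the lattice; `c` is chosen last, after the shear caused by `a` and `b`. -/
theorem exists_heis_reduction (x y z : ℝ) : ∃ a b c : ℤ,
    (x + a, y + b, z + c + (x * b - a * y)) ∈
      Set.Icc (0 : ℝ) 1 ×ˢ Set.Icc (0 : ℝ) 1 ×ˢ Set.Icc (0 : ℝ) 1 := by
  have h : ∀ t : ℝ, t + ((-⌊t⌋ : ℤ) : ℝ) ∈ Set.Icc (0 : ℝ) 1 := fun t => by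
    push_cast
    exact ⟨by linarith [Int.floor_le t], by linarith [Int.lt_floor_add_one t]⟩
  refine ⟨-⌊x⌋, -⌊y⌋, -⌊z + (x * (-⌊y⌋ : ℤ) - (-⌊x⌋ : ℤ) * y)⌋, h x, h y, ?_⟩
  have := h (z + (x * (-⌊y⌋ : ℤ) - (-⌊x⌋ : ℤ) * y))
  convert this using 1
  ring

namespace HeisPeriodic

variable {F : ℝ → ℝ → ℝ → ℂ}

theorem exists_bound (hF : HeisPeriodic F) : ∃ C > 0, ∀ x y z, ‖F x y z‖ ≤ C := by
  obtain ⟨C, hC⟩ := ((isCompact_Icc (a := (0 : ℝ)) (b := 1)).prod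
    ((isCompact_Icc (a := (0 : ℝ)) (b := 1)).prod
      (isCompact_Icc (a := (0 : ℝ)) (b := 1)))).exists_bound_of_continuousOn hF.cont.continuousOn
  refine ⟨max C 1, by positivity, fun x y z => ?_⟩
  obtain ⟨a, b, c, h⟩ := exists_heis_reduction x y z
  rw [← hF.right x y z a b c]
  exact (hC _ h).trans (le_max_left _ _)

/-- The displacement is left multiplication by `(0, q.1, q.2)`, which commutes with the right action
of the lattice. Uniformity therefore only has to be checked on the compact unit cube. -/
theorem eventually_norm_translate_sub_lt (hF : HeisPeriodic F) {ε : ℝ} (hε : 0 < ε) :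
    ∀ᶠ q : ℝ × ℝ in 𝓝 0, ∀ x y z, ‖F x (y + q.1) (z - x * q.1 + q.2) - F x y z‖ < ε := by
  have hK := (isCompact_Icc (a := (0 : ℝ)) (b := 1)).prod
    ((isCompact_Icc (a := (0 : ℝ)) (b := 1)).prod (isCompact_Icc (a := (0 : ℝ)) (b := 1)))
  have hcont : Continuous fun s : (ℝ × ℝ) × (ℝ × ℝ × ℝ) =>
      ‖F s.2.1 (s.2.2.1 + s.1.1) (s.2.2.2 - s.2.1 * s.1.1 + s.1.2) - F s.2.1 s.2.2.1 s.2.2.2‖ := by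
    have h1 : Continuous fun s : (ℝ × ℝ) × (ℝ × ℝ × ℝ) =>
        F s.2.1 (s.2.2.1 + s.1.1) (s.2.2.2 - s.2.1 * s.1.1 + s.1.2) :=
      hF.cont.comp (f := fun s : (ℝ × ℝ) × (ℝ × ℝ × ℝ) =>
        (s.2.1, s.2.2.1 + s.1.1, s.2.2.2 - s.2.1 * s.1.1 + s.1.2)) (by fun_prop)
    have h2 : Continuous fun s : (ℝ × ℝ) × (ℝ × ℝ × ℝ) => F s.2.1 s.2.2.1 s.2.2.2 :=
      hF.cont.comp continuous_snd
    exact (h1.sub h2).norm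
  have h := hK.eventually_forall_of_forall_eventually (x₀ := (0 : ℝ × ℝ))
    (P := fun (q : ℝ × ℝ) (s : ℝ × ℝ × ℝ) =>
      ‖F s.1 (s.2.1 + q.1) (s.2.2 - s.1 * q.1 + q.2) - F s.1 s.2.1 s.2.2‖ < ε) (by
      intro s _
      exact (hcont.tendsto (0, s)).eventually_lt_const (by simpa using hε))
  filter_upwards [h] with q hq x y z
  obtain ⟨a, b, c, hs⟩ := exists_heis_reduction x y z
  have h1 := hq _ hs
  dsimp only at h1
  rw [hF.right x y z a b c] at h1
  rw [← hF.right x (y + q.1) (z - x * q.1 + q.2) a b c]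
  convert h1 using 4
  · ring
  · ring

end HeisPeriodic

/-! ### The vertical cocycle and its correlations on the torus -/

section cocycle

variable (α β : ℝ) (A B : ℤ) (h₀ : C(UnitAddTorus (Fin 2), ℝ))

/-- The vertical displacement of the `j`-th iterate of the skew product. -/
noncomputable def vertDisp (j : ℕ) (x y : ℝ) : ℝ :=
  ∑ i ∈ range j, (h₀ (toTorus₂ (x + i * α) (y + i * β)) + A * (x + i * α) + B * (y + i * β)) +
    j * (α * y - β * x)

/-- The cocycle identity. The group twist `α(y+iβ) - β(x+iα) = αy - βx` is the same at every step,
so the term `j(αy - βx)` is compatible with composition. -/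
theorem vertDisp_add (n k : ℕ) (x y : ℝ) : vertDisp α β A B h₀ (n + k) x y =
    vertDisp α β A B h₀ n x y + vertDisp α β A B h₀ k (x + n * α) (y + n * β) := by
  unfold vertDisp
  rw [sum_range_add]
  have e : ∀ (i : ℕ) (u v : ℝ), u + ((n + i : ℕ) : ℝ) * v = u + n * v + i * v := by
    intro i u v; push_cast; ring
  simp_rw [e]
  ring

theorem toTorus₂_add_one_left (x y : ℝ) : toTorus₂ (x + 1) y = toTorus₂ x y := by
  ext i; fin_cases i <;> simp [toTorus₂]

theorem toTorus₂_add_one_right (x y : ℝ) : toTorus₂ x (y + 1) = toTorus₂ x y := by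
  ext i; fin_cases i <;> simp [toTorus₂]

theorem vertDisp_add_one_left (j : ℕ) (x y : ℝ) : vertDisp α β A B h₀ j (x + 1) y =
    vertDisp α β A B h₀ j x y + j * A - j * β := by
  unfold vertDisp
  have e : ∀ i : ℕ, x + 1 + i * α = x + i * α + 1 := fun i => by ring
  simp_rw [e, toTorus₂_add_one_left, mul_add, sum_add_distrib]
  simp
  ring

theorem vertDisp_add_one_right (j : ℕ) (x y : ℝ) : vertDisp α β A B h₀ j x (y + 1) =
    vertDisp α β A B h₀ j x y + j * B + j * α := by
  unfold vertDisp
  have e : ∀ i : ℕ, y + 1 + i * β = y + i * β + 1 := fun i => by ring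
  simp_rw [e, toTorus₂_add_one_right, mul_add, sum_add_distrib]
  simp
  ring

theorem vertDisp_add_right (j : ℕ) (x y r : ℝ) : vertDisp α β A B h₀ j x (y + r) =
    vertDisp α β A B h₀ j x y + (j * (B + α) * r +
      ∑ i ∈ range j, (h₀ (toTorus₂ x y + (i • toTorus₂ α β + toTorus₂ 0 r)) -
        h₀ (toTorus₂ x y + i • toTorus₂ α β))) := by
  unfold vertDisp
  have e1 : ∀ i : ℕ, toTorus₂ x y + i • toTorus₂ α β = toTorus₂ (x + i * α) (y + i * β) := by
    intro i; rw [← toTorus₂_nsmul, ← toTorus₂_add]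
  have e2 : ∀ i : ℕ, toTorus₂ x y + (i • toTorus₂ α β + toTorus₂ 0 r) =
      toTorus₂ (x + i * α) (y + r + i * β) := by
    intro i; rw [← add_assoc, e1, ← toTorus₂_add]; congr 1 <;> ring
  simp_rw [e1, e2, mul_add, sum_sub_distrib, sum_add_distrib]
  simp
  ring

theorem continuous_vertDisp (j : ℕ) :
    Continuous fun p : ℝ × ℝ => vertDisp α β A B h₀ j p.1 p.2 := by
  unfold vertDisp
  have h1 : ∀ i : ℕ, Continuous fun p : ℝ × ℝ => h₀ (toTorus₂ (p.1 + i * α) (p.2 + i * β)) :=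
    fun i => h₀.continuous.comp (continuous_toTorus₂.comp
      (f := fun p : ℝ × ℝ => (p.1 + i * α, p.2 + i * β)) (by fun_prop))
  exact Continuous.add (continuous_finsetSum _ fun i _ =>
    ((h1 i).add (by fun_prop)).add (by fun_prop)) (by fun_prop)

variable {α β A B h₀} {F : ℝ → ℝ → ℝ → ℂ} {m : ℤ}

/-- The two factors acquire the same phase under a vertical translation and under each lattice
generator, so the product depends only on the base point. The integers `jA` and `jB` produced by the
degrees are absorbed by central periodicity. -/
theorem exists_torus_correlation (hF : HeisPeriodic F)
    (hFm : ∀ x y z s, F x y (z + s) = expi (m * s) * F x y z) (α β : ℝ) (A B : ℤ)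
    (h₀ : C(UnitAddTorus (Fin 2), ℝ)) (j : ℕ) :
    ∃ G : C(UnitAddTorus (Fin 2), ℂ), ∀ x y z, G (toTorus₂ x y) =
      F (x + j * α) (y + j * β) (z + vertDisp α β A B h₀ j x y) * conj (F x y z) := by
  suffices h : ∃ G : C(UnitAddTorus (Fin 2), ℂ), ∀ x y, G (toTorus₂ x y) =
      F (x + j * α) (y + j * β) (vertDisp α β A B h₀ j x y) * conj (F x y 0) by
    obtain ⟨G, hG⟩ := h
    refine ⟨G, fun x y z => ?_⟩
    rw [hG, add_comm z, hFm _ _ _ z]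
    have h1 : F x y z = expi (m * z) * F x y 0 := by rw [← hFm, zero_add]
    rw [h1, map_mul]
    linear_combination (- F (x + j * α) (y + j * β) (vertDisp α β A B h₀ j x y) *
      conj (F x y 0)) * expi_mul_conj (m * z)
  refine exists_torus_descent _ ?_ ?_ ?_
  · have h1 : Continuous fun p : ℝ × ℝ =>
        F (p.1 + j * α) (p.2 + j * β) (vertDisp α β A B h₀ j p.1 p.2) :=
      hF.cont.comp (f := fun p : ℝ × ℝ =>
        (p.1 + j * α, p.2 + j * β, vertDisp α β A B h₀ j p.1 p.2))
        (by have := continuous_vertDisp α β A B h₀ j; fun_prop)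
    have h2 : Continuous fun p : ℝ × ℝ => F p.1 p.2 0 :=
      hF.cont.comp (f := fun p : ℝ × ℝ => (p.1, p.2, (0 : ℝ))) (by fun_prop)
    exact h1.mul (Complex.continuous_conj.comp h2)
  · intro x y
    have h1 : F (x + 1 + j * α) (y + j * β) (vertDisp α β A B h₀ j (x + 1) y) =
        expi (m * y) * F (x + j * α) (y + j * β) (vertDisp α β A B h₀ j x y) := by
      rw [← hFm, ← hF.right (x + j * α) (y + j * β) (vertDisp α β A B h₀ j x y + y) 1 0 (j * A),
        vertDisp_add_one_left]
      congr 1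
      all_goals push_cast; ring
    have h2 : F (x + 1) y 0 = expi (m * y) * F x y 0 := by
      rw [← hFm, ← hF.right x y (0 + y) 1 0 0]
      congr 1
      all_goals push_cast; ring
    rw [h1, h2, map_mul]
    linear_combination (F (x + j * α) (y + j * β) (vertDisp α β A B h₀ j x y) *
      conj (F x y 0)) * expi_mul_conj (m * y)
  · intro x y
    have h1 : F (x + j * α) (y + 1 + j * β) (vertDisp α β A B h₀ j x (y + 1)) =
        expi (m * (-x)) * F (x + j * α) (y + j * β) (vertDisp α β A B h₀ j x y) := by
      rw [← hFm, ← hF.right (x + j * α) (y + j * β) (vertDisp α β A B h₀ j x y + -x) 0 1 (j * B),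
        vertDisp_add_one_right]
      congr 1
      all_goals push_cast; ring
    have h2 : F x (y + 1) 0 = expi (m * (-x)) * F x y 0 := by
      rw [← hFm, ← hF.right x y (0 + -x) 0 1 0]
      congr 1
      all_goals push_cast; ring
    rw [h1, h2, map_mul]
    linear_combination (F (x + j * α) (y + j * β) (vertDisp α β A B h₀ j x y) *
      conj (F x y 0)) * expi_mul_conj (m * (-x))

theorem norm_mul_conj_sub_le {a b c d : ℂ} (ha : ‖a‖ ≤ 1) (hd : ‖d‖ ≤ 1) :
    ‖a * conj b - c * conj d‖ ≤ ‖a - c‖ + ‖b - d‖ := by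
  have : a * conj b - c * conj d = a * conj (b - d) + (a - c) * conj d := by
    rw [map_sub]; ring
  rw [this]
  refine (norm_add_le _ _).trans ?_
  rw [norm_mul, norm_mul, RCLike.norm_conj, RCLike.norm_conj, add_comm]
  exact add_le_add (mul_le_of_le_one_right (norm_nonneg _) hd)
    (mul_le_of_le_one_left (norm_nonneg _) ha)

/-- Compare with left translation by `(0, r, 0)`, which is uniformly close to the identity on the
nilmanifold. Its vertical corrections at the two ends of the orbit segment are `(x + jα)r` and `xr`;
their difference `jαr` joins the `j(B+α)r` of the cocycle, giving `B + 2α`. The closeness does not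
depend on `j`. -/
theorem eventually_norm_shift_sub_le (hF : HeisPeriodic F)
    (hFm : ∀ x y z s, F x y (z + s) = expi (m * s) * F x y z) (hF1 : ∀ x y z, ‖F x y z‖ ≤ 1)
    {G : ℕ → C(UnitAddTorus (Fin 2), ℂ)}
    (hG : ∀ j x y z, G j (toTorus₂ x y) =
      F (x + j * α) (y + j * β) (z + vertDisp α β A B h₀ j x y) * conj (F x y z))
    {ε : ℝ} (hε : 0 < ε) : ∀ᶠ r : ℝ in 𝓝 0, ∀ j w, ‖G j (w + toTorus₂ 0 r) -
      expi (m * (j * (B + 2 * α) * r + ∑ i ∈ range j,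
        (h₀ (w + (i • toTorus₂ α β + toTorus₂ 0 r)) - h₀ (w + i • toTorus₂ α β)))) * G j w‖ ≤ ε := by
  have h1 := hF.eventually_norm_translate_sub_lt (ε := ε / 2) (by positivity)
  have h2 : Tendsto (fun r : ℝ => (r, (0 : ℝ))) (𝓝 0) (𝓝 0) := by
    have : Continuous fun r : ℝ => (r, (0 : ℝ)) := by fun_prop
    exact this.tendsto 0
  filter_upwards [h2.eventually h1] with r hr j w
  obtain ⟨x, y, rfl⟩ := toTorus₂_surjective w
  rw [← toTorus₂_add, add_zero, hG j x (y + r) 0, hG j x y 0, vertDisp_add_right]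
  set E := ∑ i ∈ range j,
        (h₀ (toTorus₂ x y + (i • toTorus₂ α β + toTorus₂ 0 r)) -
          h₀ (toTorus₂ x y + i • toTorus₂ α β))
  set τ := vertDisp α β A B h₀ j x y
  simp only [zero_add]
  have hU := hr (x + j * α) (y + j * β) τ
  have hV := hr x y 0
  simp only [add_zero] at hU hV
  have e1 : F (x + j * α) (y + r + j * β) (τ + (j * (B + α) * r + E)) =
      expi (m * (j * (B + α) * r + E + (x + j * α) * r)) *
        F (x + j * α) (y + j * β + r) (τ - (x + j * α) * r) := by
    rw [← hFm]
    congr 1 <;> ring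
  have e2 : F x (y + r) 0 = expi (m * (x * r)) * F x (y + r) (0 - x * r) := by
    rw [← hFm]
    congr 1
    ring
  have e3 : expi (m * (j * (B + α) * r + E + (x + j * α) * r)) * conj (expi (m * (x * r))) =
      expi (m * (j * (B + 2 * α) * r + E)) := by
    rw [conj_expi, ← expi_add]
    congr 1
    ring
  rw [e1, e2, map_mul, mul_mul_mul_comm, e3, ← mul_sub, norm_mul, norm_expi, one_mul]
  refine (norm_mul_conj_sub_le (hF1 _ _ _) (hF1 _ _ _)).trans ?_
  linarith

end cocycle

/-! ### Decay of correlations at non-zero vertical frequency -/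

section correlations

variable {α β : ℝ} {A B : ℤ} {h₀ : C(UnitAddTorus (Fin 2), ℝ)} {F : ℝ → ℝ → ℝ → ℂ} {m : ℤ}
  {G : ℕ → C(UnitAddTorus (Fin 2), ℂ)} {K r₀ : ℝ}

theorem integrable_torus_real (g : C(UnitAddTorus (Fin 2), ℝ)) :
    Integrable g (torusHaar (Fin 2)) :=
  g.continuous.integrable_of_hasCompactSupport (HasCompactSupport.of_compactSpace _)

theorem norm_torus_correlation_le (hF1 : ∀ x y z, ‖F x y z‖ ≤ 1)
    (hG : ∀ j x y z, G j (toTorus₂ x y) =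
      F (x + j * α) (y + j * β) (z + vertDisp α β A B h₀ j x y) * conj (F x y z))
    (j : ℕ) (w : UnitAddTorus (Fin 2)) : ‖G j w‖ ≤ 1 := by
  obtain ⟨x, y, rfl⟩ := toTorus₂_surjective w
  rw [hG j x y 0, norm_mul, RCLike.norm_conj]
  exact mul_le_one₀ (hF1 _ _ _) (norm_nonneg _) (hF1 _ _ _)

/-- Over `pk` steps a shift by `s/k` accumulates the phase `p(B+2α)s`, independent of `k`. The
remaining phase is the sum of increments of `h₀`, negligible in `L²`. -/
theorem tendsto_integral_norm_shift_sub (hF : HeisPeriodic F)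
    (hFm : ∀ x y z s, F x y (z + s) = expi (m * s) * F x y z) (hF1 : ∀ x y z, ‖F x y z‖ ≤ 1)
    (hαβ : LinearIndependent ℚ ![α, β, 1])
    (hG : ∀ j x y z, G j (toTorus₂ x y) =
      F (x + j * α) (y + j * β) (z + vertDisp α β A B h₀ j x y) * conj (F x y z))
    (hr₀ : 0 < r₀) (hLip : ∀ r, 0 < r → r < r₀ → ∀ w, |h₀ (w + toTorus₂ 0 r) - h₀ w| ≤ K * r)
    (p : ℕ) (s : ℝ) :
    Tendsto (fun k : ℕ => ∫ w, ‖G (p * k) (w + toTorus₂ 0 (s / k)) -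
      expi (m * (p * (B + 2 * α) * s)) * G (p * k) w‖ ∂(torusHaar (Fin 2))) atTop (𝓝 0) := by
  let E : ℕ → C(UnitAddTorus (Fin 2), ℝ) := fun k =>
    ⟨fun w => ∑ i ∈ range (p * k), (h₀ (w + (i • toTorus₂ α β + toTorus₂ 0 (s / k))) -
      h₀ (w + i • toTorus₂ α β)), by fun_prop⟩
  have hE : Tendsto (fun k => ∫ w, (E k w) ^ 2 ∂(torusHaar (Fin 2))) atTop (𝓝 0) := by
    have h := tendsto_integral_sq_sum_increments (mFourier_toTorus₂_ne_one hαβ)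
      (⟨fun w => (h₀ w : ℂ), by fun_prop⟩ : C(UnitAddTorus (Fin 2), ℂ)) hr₀ (K := K)
      (fun r hr hr' w => by
        simp only [ContinuousMap.coe_mk]
        rw [← Complex.ofReal_sub, Complex.norm_real]
        exact hLip r hr hr' w) p s
    refine h.congr fun k => ?_
    congr 1
    ext w
    simp only [ContinuousMap.coe_mk, E]
    simp_rw [← Complex.ofReal_sub]
    rw [← Complex.ofReal_sum, Complex.norm_real, Real.norm_eq_abs, sq_abs]
  refine tendsto_order.2 ⟨fun a ha => Eventually.of_forall fun k =>
    ha.trans_le (integral_nonneg fun _ => norm_nonneg _), fun ε hε => ?_⟩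
  have hrk : Tendsto (fun k : ℕ => s / (k : ℝ)) atTop (𝓝 0) :=
    tendsto_const_div_atTop_nhds_zero_nat s
  -- This constant comes from `t ≤ ε/4 + t²/ε` with `t = 2π|m||E|`, which trades the first power of
  -- the error for its square.
  set D : ℝ := (2 * Real.pi * |(m : ℝ)|) ^ 2 / ε with hD
  have hD0 : 0 ≤ D := by positivity
  have hDE : Tendsto (fun k => D * ∫ w, (E k w) ^ 2 ∂(torusHaar (Fin 2))) atTop (𝓝 0) := by
    simpa using hE.const_mul D
  filter_upwards [hrk.eventually (eventually_norm_shift_sub_le hF hFm hF1 hG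
    (show 0 < ε / 4 by positivity)), hDE.eventually_lt_const (show 0 < ε / 4 by positivity),
    eventually_gt_atTop 0] with k hk1 hk2 hk0
  have hk0' : (k : ℝ) ≠ 0 := by exact_mod_cast hk0.ne'
  have hpt : ∀ w, ‖G (p * k) (w + toTorus₂ 0 (s / k)) -
      expi (m * (p * (B + 2 * α) * s)) * G (p * k) w‖ ≤ ε / 2 + D * (E k w) ^ 2 := by
    intro w
    have h1 := hk1 (p * k) w
    have e : ((p * k : ℕ) : ℝ) * (B + 2 * α) * (s / k) = p * (B + 2 * α) * s := by
      push_cast; field_simp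
    rw [e] at h1
    change ‖_ - expi (m * (p * (B + 2 * α) * s + E k w)) * _‖ ≤ _ at h1
    have h2 : ‖expi (m * (p * (B + 2 * α) * s + E k w)) * G (p * k) w -
        expi (m * (p * (B + 2 * α) * s)) * G (p * k) w‖ ≤ 2 * Real.pi * |(m : ℝ)| * |E k w| := by
      rw [mul_add, expi_add, ← sub_mul, norm_mul, ← mul_sub_one, norm_mul, norm_expi, one_mul]
      refine (mul_le_of_le_one_right (norm_nonneg _)
        (norm_torus_correlation_le hF1 hG _ _)).trans ?_
      refine (norm_expi_sub_one_le _).trans (le_of_eq ?_)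
      rw [abs_mul]; ring
    have h3 : 2 * Real.pi * |(m : ℝ)| * |E k w| ≤ ε / 4 + D * (E k w) ^ 2 := by
      have h4 : D * (E k w) ^ 2 = (2 * Real.pi * |(m : ℝ)| * |E k w|) ^ 2 / ε := by
        rw [hD, mul_pow (2 * Real.pi * |(m : ℝ)|), sq_abs]; ring
      rw [h4]
      set t := 2 * Real.pi * |(m : ℝ)| * |E k w|
      rw [← sub_le_iff_le_add', le_div_iff₀ hε]
      nlinarith [sq_nonneg (t - ε / 2)]
    have := norm_sub_le_norm_sub_add_norm_sub (G (p * k) (w + toTorus₂ 0 (s / k)))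
      (expi (m * (p * (B + 2 * α) * s + E k w)) * G (p * k) w)
      (expi (m * (p * (B + 2 * α) * s)) * G (p * k) w)
    linarith
  have hi : Integrable (fun w => D * (E k w) ^ 2) (torusHaar (Fin 2)) :=
    integrable_torus_real (⟨fun w => D * (E k w) ^ 2, by fun_prop⟩ : C(UnitAddTorus (Fin 2), ℝ))
  have hle := integral_mono_of_nonneg (μ := torusHaar (Fin 2))
    (Eventually.of_forall fun w => norm_nonneg (G (p * k) (w + toTorus₂ 0 (s / k)) -
      expi (m * (p * (B + 2 * α) * s)) * G (p * k) w))
    ((integrable_const (ε / 2)).add hi) (Eventually.of_forall hpt)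
  refine hle.trans_lt ?_
  change ∫ w, (ε / 2 + D * (E k w) ^ 2) ∂(torusHaar (Fin 2)) < ε
  rw [integral_add (integrable_const _) hi, integral_const_mul]
  simp only [integral_const, probReal_univ, one_smul]
  linarith

theorem tendsto_integral_torus_correlation (hF : HeisPeriodic F)
    (hFm : ∀ x y z s, F x y (z + s) = expi (m * s) * F x y z) (hF1 : ∀ x y z, ‖F x y z‖ ≤ 1)
    (hm : m ≠ 0) (hαβ : LinearIndependent ℚ ![α, β, 1])
    (hG : ∀ j x y z, G j (toTorus₂ x y) =
      F (x + j * α) (y + j * β) (z + vertDisp α β A B h₀ j x y) * conj (F x y z))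
    (hr₀ : 0 < r₀) (hLip : ∀ r, 0 < r → r < r₀ → ∀ w, |h₀ (w + toTorus₂ 0 r) - h₀ w| ≤ K * r)
    {p q : ℕ} (hp : 0 < p) (hq : 0 < q) (hpq : p ≠ q) (w₀ : UnitAddTorus (Fin 2)) :
    Tendsto (fun k : ℕ => ∫ w, G (p * k) (w₀ + p • w) * conj (G (q * k) (w₀ + q • w))
      ∂(torusHaar (Fin 2))) atTop (𝓝 0) := by
  -- A relation `B + 2α = 0` would make `α` rational.
  have hκ : (B + 2 * α : ℝ) ≠ 0 := by
    intro h0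
    have h4 := Fintype.linearIndependent_iff.1 hαβ ![2, 0, (B : ℚ)] (by
      simp only [Fin.sum_univ_three, Matrix.cons_val_zero, Matrix.cons_val_one,
        Matrix.cons_val_two, Matrix.head_cons, Matrix.tail_cons, Rat.smul_def]
      push_cast
      simp
      linarith) 0
    norm_num at h4
  have hpq' : ((p : ℝ) ^ 2 - q ^ 2) ≠ 0 := by
    intro h0
    have : (p : ℝ) ^ 2 = q ^ 2 := by linarith
    have h2 : (p : ℝ) = q := (pow_left_inj₀ (by positivity) (by positivity) two_ne_zero).1 this
    exact hpq (by exact_mod_cast h2)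
  have hm' : (m : ℝ) ≠ 0 := by exact_mod_cast hm
  -- One factor `p` of the phase comes from the `pk` steps and another from the dilation of `w`.
  -- This `s` makes the difference of the phases for `p` and `q` a half turn.
  set s : ℝ := 1 / (2 * (m * (B + 2 * α) * ((p : ℝ) ^ 2 - q ^ 2))) with hs
  let lam : ℕ → ℂ := fun p => expi (m * (p * (B + 2 * α) * (p * s)))
  have hlam : lam p * conj (lam q) = -1 := by
    simp only [lam]
    rw [conj_expi, ← expi_add, ← expi_half]
    congr 1
    have : m * (p * (B + 2 * α) * (p * s)) + -(m * (q * (B + 2 * α) * (q * s))) =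
      (m * (B + 2 * α) * ((p : ℝ) ^ 2 - q ^ 2)) * s := by ring
    rw [this, hs]
    field_simp
  have hlam1 : ∀ p, ‖lam p‖ = 1 := fun p => norm_expi _
  let I : ℕ → ℕ → ℝ := fun p k => ∫ w, ‖G (p * k) (w₀ + p • (w + toTorus₂ 0 (s / k))) -
    lam p * G (p * k) (w₀ + p • w)‖ ∂(torusHaar (Fin 2))
  have hI : ∀ p, 0 < p → Tendsto (I p) atTop (𝓝 0) := by
    intro p hp
    refine (tendsto_integral_norm_shift_sub hF hFm hF1 hαβ hG hr₀ hLip p (p * s)).congr fun k => ?_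
    refine (integral_torus_affine (⟨fun w => ‖G (p * k) (w + toTorus₂ 0 (p * s / k)) -
      expi (m * (p * (B + 2 * α) * (p * s))) * G (p * k) w‖, by fun_prop⟩ :
        C(UnitAddTorus (Fin 2), ℝ)) hp w₀).symm.trans ?_
    simp only [ContinuousMap.coe_mk, I, lam]
    have e : toTorus₂ 0 (p * s / k) = p • toTorus₂ 0 (s / k) := by
      rw [← toTorus₂_nsmul, mul_zero, mul_div_assoc]
    simp_rw [e, smul_add, add_assoc]
  have hsum := (hI p hp).add (hI q hq)
  rw [add_zero] at hsum
  refine squeeze_zero_norm (fun k => ?_) hsum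
  let Φ : C(UnitAddTorus (Fin 2), ℂ) :=
    ⟨fun w => G (p * k) (w₀ + p • w) * conj (G (q * k) (w₀ + q • w)), by fun_prop⟩
  have hshift := integral_add_right_eq_self (μ := torusHaar (Fin 2)) (fun w => Φ w)
    (toTorus₂ 0 (s / k))
  change ‖∫ w, Φ w ∂(torusHaar (Fin 2))‖ ≤ I p k + I q k
  have hΦi := integrable_torus Φ
  have hΦi' : Integrable (fun w => Φ (w + toTorus₂ 0 (s / k))) (torusHaar (Fin 2)) :=
    integrable_torus (⟨fun w => Φ (w + toTorus₂ 0 (s / k)), by fun_prop⟩ :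
      C(UnitAddTorus (Fin 2), ℂ))
  -- By invariance of Haar measure the shift leaves the integral unchanged, while the phases nearly
  -- reverse the sign of the integrand.
  have h2 : 2 * ∫ w, Φ w ∂(torusHaar (Fin 2)) =
      ∫ w, (Φ (w + toTorus₂ 0 (s / k)) - (-1) * Φ w) ∂(torusHaar (Fin 2)) := by
    rw [integral_sub hΦi' (hΦi.const_mul _), hshift, integral_const_mul]; ring
  have hIi : ∀ p, Integrable (fun w => ‖G (p * k) (w₀ + p • (w + toTorus₂ 0 (s / k))) -
      lam p * G (p * k) (w₀ + p • w)‖) (torusHaar (Fin 2)) := fun p =>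
    integrable_torus_real (⟨fun w => ‖G (p * k) (w₀ + p • (w + toTorus₂ 0 (s / k))) -
      lam p * G (p * k) (w₀ + p • w)‖, by fun_prop⟩ : C(UnitAddTorus (Fin 2), ℝ))
  have h3 : ‖2 * ∫ w, Φ w ∂(torusHaar (Fin 2))‖ ≤ I p k + I q k := by
    rw [h2]
    refine (norm_integral_le_of_norm_le ((hIi p).add (hIi q))
      (Eventually.of_forall fun w => ?_)).trans (le_of_eq (integral_add (hIi p) (hIi q)))
    simp only [Φ, ContinuousMap.coe_mk]
    have e : -1 * (G (p * k) (w₀ + p • w) * conj (G (q * k) (w₀ + q • w))) =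
        (lam p * G (p * k) (w₀ + p • w)) * conj (lam q * G (q * k) (w₀ + q • w)) := by
      rw [← hlam, map_mul]; ring
    rw [e]
    refine norm_mul_conj_sub_le (norm_torus_correlation_le hF1 hG _ _) ?_
    rw [norm_mul, hlam1, one_mul]
    exact norm_torus_correlation_le hF1 hG _ _
  rw [norm_mul] at h3
  have h4 : (2 : ℝ) = ‖(2 : ℂ)‖ := by simp
  rw [← h4] at h3
  linarith [norm_nonneg (∫ w, Φ w ∂(torusHaar (Fin 2)))]

/-- Functions of non-zero vertical frequency, sampled along an orbit of the skew product, have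
asymptotically uncorrelated dilates. -/
theorem tendsto_correlation_of_vertical_frequency (hF : HeisPeriodic F)
    (hFm : ∀ x y z s, F x y (z + s) = expi (m * s) * F x y z) (hF1 : ∀ x y z, ‖F x y z‖ ≤ 1)
    (hm : m ≠ 0) (hαβ : LinearIndependent ℚ ![α, β, 1])
    (hr₀ : 0 < r₀) (hLip : ∀ r, 0 < r → r < r₀ → ∀ w, |h₀ (w + toTorus₂ 0 r) - h₀ w| ≤ K * r)
    (x y z : ℝ) {u : ℕ → ℂ}
    (hu : ∀ n : ℕ, u n = F (x + n * α) (y + n * β) (z + vertDisp α β A B h₀ n x y))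
    {p q : ℕ} (hp : 0 < p) (hq : 0 < q) (hpq : p ≠ q) :
    Tendsto (fun N : ℕ => (1 / (N : ℂ)) * ∑ n ∈ Icc 1 N, u (p * n) * conj (u (q * n)))
      atTop (𝓝 0) := by
  choose G hG using exists_torus_correlation hF hFm α β A B h₀
  have hcorr : ∀ n k, u (n + k) * conj (u n) = G k (toTorus₂ x y + n • toTorus₂ α β) := by
    intro n k
    rw [← toTorus₂_nsmul, ← toTorus₂_add, hG k _ _ (z + vertDisp α β A B h₀ n x y), hu, hu,
      vertDisp_add]
    congr 2
    · push_cast; ring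
    · push_cast; ring
    · ring
  have hu1 : ∀ n, ‖u n‖ ≤ 1 := fun n => by rw [hu]; exact hF1 _ _ _
  simp_rw [sum_Icc_one_eq_sum_range]
  let Φ : ℕ → C(UnitAddTorus (Fin 2), ℂ) := fun k =>
    ⟨fun w => G (p * k) (toTorus₂ x y + p • w) * conj (G (q * k) (toTorus₂ x y + q • w)),
      by fun_prop⟩
  refine tendsto_average_zero_of_correlations
    (fun n => u (p * (n + 1)) * conj (u (q * (n + 1)))) (fun n => ?_)
    (fun k => ∫ w, Φ k w ∂(torusHaar (Fin 2))) (fun k => ?_)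
    (tendsto_integral_torus_correlation hF hFm hF1 hm hαβ hG hr₀ hLip hp hq hpq _)
  · rw [norm_mul, RCLike.norm_conj]
    exact mul_le_one₀ (hu1 _) (norm_nonneg _) (hu1 _)
  -- The equidistributing orbit starts at `(α, β)` and not at 0 because the average begins at `n =
  -- 1`.
  · refine (tendsto_average_torus (mFourier_toTorus₂_ne_one hαβ) (Φ k) (toTorus₂ α β)).congr
      fun N => ?_
    congr 1
    refine sum_congr rfl fun n _ => ?_
    have e : ∀ p : ℕ, p • (toTorus₂ α β + n • toTorus₂ α β) = (p * (n + 1)) • toTorus₂ α β := by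
      intro p; rw [mul_smul, add_smul, one_smul, add_comm]
    simp only [Φ, ContinuousMap.coe_mk]
    rw [e, e, ← hcorr, ← hcorr]
    simp only [map_mul, Complex.conj_conj]
    have e2 : ∀ p : ℕ, p * (n + k + 1) = p * (n + 1) + p * k := fun p => by ring
    rw [e2, e2]
    ring

end correlations

/-! ### Möbius orthogonality and the case of torus rotations -/

/-- The sequence `u` is asymptotically orthogonal to the Möbius function. -/
def MoebiusOrthogonal (u : ℕ → ℂ) : Prop :=
  Tendsto (fun N : ℕ => (1 / (N : ℂ)) * ∑ n ∈ Icc 1 N, u n * (ArithmeticFunction.moebius n : ℂ))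
    atTop (𝓝 0)

namespace MoebiusOrthogonal

theorem add {u v : ℕ → ℂ} (hu : MoebiusOrthogonal u) (hv : MoebiusOrthogonal v) :
    MoebiusOrthogonal fun n => u n + v n := by
  have := Tendsto.add hu hv
  rw [add_zero] at this
  refine this.congr fun N => ?_
  simp_rw [add_mul, sum_add_distrib, mul_add]

theorem const_mul {u : ℕ → ℂ} (c : ℂ) (hu : MoebiusOrthogonal u) :
    MoebiusOrthogonal fun n => c * u n := by
  have := Tendsto.const_mul c hu
  rw [mul_zero] at this
  refine this.congr fun N => ?_
  simp_rw [mul_assoc, ← mul_sum]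
  ring

theorem zero : MoebiusOrthogonal fun _ => 0 := by
  simp [MoebiusOrthogonal]

theorem of_uniform_approx {u : ℕ → ℂ}
    (h : ∀ ε > 0, ∃ v, MoebiusOrthogonal v ∧ ∀ n, ‖u n - v n‖ ≤ ε) : MoebiusOrthogonal u := by
  refine Metric.tendsto_atTop.2 fun ε hε => ?_
  obtain ⟨v, hv, huv⟩ := h (ε / 2) (by positivity)
  obtain ⟨N₀, hN₀⟩ := Metric.tendsto_atTop.1 hv (ε / 2) (by positivity)
  refine ⟨N₀, fun N hN => ?_⟩
  have h1 := hN₀ N hN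
  rw [dist_zero_right] at h1 ⊢
  have h2 : ‖(1 / (N : ℂ)) * ∑ n ∈ Icc 1 N, (u n - v n) * (ArithmeticFunction.moebius n : ℂ)‖ ≤
      ε / 2 := by
    rw [norm_mul, norm_div, norm_one, Complex.norm_natCast, one_div_mul_eq_div]
    refine div_le_of_le_mul₀ (Nat.cast_nonneg _) (by positivity) ?_
    refine (norm_sum_le_of_le (n := fun _ => ε / 2) _ fun n _ => ?_).trans ?_
    · rw [norm_mul]
      exact (mul_le_of_le_one_right (norm_nonneg _) (norm_moebius_le n)).trans (huv n)
    · simp [mul_comm]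
  have h3 : (1 / (N : ℂ)) * ∑ n ∈ Icc 1 N, u n * (ArithmeticFunction.moebius n : ℂ) =
      (1 / (N : ℂ)) * ∑ n ∈ Icc 1 N, (u n - v n) * (ArithmeticFunction.moebius n : ℂ) +
      (1 / (N : ℂ)) * ∑ n ∈ Icc 1 N, v n * (ArithmeticFunction.moebius n : ℂ) := by
    rw [← mul_add, ← sum_add_distrib]
    congr 1
    exact sum_congr rfl fun n _ => by ring
  rw [h3]
  exact (norm_add_le _ _).trans_lt (by linarith)

end MoebiusOrthogonal

/-- For `ξ ≠ 0` the correlation of two dilates is a geometric progression of ratio `χ(θ)^(p-q) ≠ 1`,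
so the criterion applies. The trivial character is not covered by it and requires the prime number
theorem. -/
theorem moebiusOrthogonal_character {d : Type*} [Fintype d] {θ : UnitAddTorus d}
    (hθ : ∀ ξ : d → ℤ, ξ ≠ 0 → mFourier ξ θ ≠ 1) (ξ : d → ℤ) (w : UnitAddTorus d) :
    MoebiusOrthogonal fun n => mFourier ξ (w + n • θ) := by
  by_cases hξ : ξ = 0
  · subst hξ
    simp only [UnitAddTorus.mFourier_zero, ContinuousMap.one_apply, MoebiusOrthogonal, one_mul]
    exact tendsto_average_moebius
  refine tendsto_moebius_of_correlations _ (fun n => (norm_mFourier_apply _ _).le) ?_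
  intro p q _ _ hpq
  have hz : mFourier (((p : ℤ) - q) • ξ) θ ≠ 1 := by
    refine hθ _ (smul_ne_zero (sub_ne_zero.2 ?_) hξ)
    exact_mod_cast hpq
  have hone : mFourier ξ w * conj (mFourier ξ w) = 1 := by
    rw [Complex.mul_conj', norm_mFourier_apply]; simp
  have hzpq : mFourier (((p : ℤ) - q) • ξ) θ = mFourier ξ θ ^ p * conj (mFourier ξ θ ^ q) := by
    have h1 : ∀ n : ℕ, mFourier ((n : ℤ) • ξ) θ = mFourier ξ θ ^ n := by
      intro n
      induction n with
      | zero => simp [UnitAddTorus.mFourier_zero]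
      | succ n ih =>
        rw [pow_succ, ← ih, ← UnitAddTorus.mFourier_add]
        congr 2
        push_cast; rw [add_smul, one_smul]
    rw [sub_smul, sub_eq_add_neg, UnitAddTorus.mFourier_add, UnitAddTorus.mFourier_neg, h1, h1]
  set z := mFourier (((p : ℤ) - q) • ξ) θ with hzdef
  have hav := (tendsto_average_pow (norm_mFourier_apply _ _) hz).const_mul z
  rw [mul_zero] at hav
  refine hav.congr fun N => ?_
  rw [sum_Icc_one_eq_sum_range, mul_left_comm, mul_sum]
  congr 1
  refine sum_congr rfl fun n _ => ?_
  rw [← hzdef, ← pow_succ', hzpq, mFourier_apply_add, mFourier_apply_add, mFourier_apply_nsmul,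
    mFourier_apply_nsmul, mul_pow, map_mul, pow_mul, pow_mul, map_pow]
  simp only [map_pow]
  linear_combination (-(mFourier ξ θ ^ p) ^ (n + 1) * (conj (mFourier ξ θ) ^ q) ^ (n + 1)) * hone

theorem moebiusOrthogonal_torus {d : Type*} [Fintype d] {θ : UnitAddTorus d}
    (hθ : ∀ ξ : d → ℤ, ξ ≠ 0 → mFourier ξ θ ≠ 1) (g : C(UnitAddTorus d, ℂ))
    (w : UnitAddTorus d) : MoebiusOrthogonal fun n => g (w + n • θ) := by
  have hspan : ∀ g ∈ Submodule.span ℂ (Set.range (mFourier (d := d))),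
      MoebiusOrthogonal fun n => g (w + n • θ) := by
    intro g hg
    induction hg using Submodule.span_induction with
    | mem g hg =>
      obtain ⟨ξ, rfl⟩ := hg
      exact moebiusOrthogonal_character hθ ξ w
    | zero => exact MoebiusOrthogonal.zero
    | add f g _ _ hf hg => exact hf.add hg
    | smul c f _ hf => exact hf.const_mul c
  refine MoebiusOrthogonal.of_uniform_approx fun ε hε => ?_
  have hdense : g ∈ closure (Submodule.span ℂ (Set.range (mFourier (d := d))) : Set _) := by
    rw [← Submodule.topologicalClosure_coe, UnitAddTorus.span_mFourier_closure_eq_top]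
    trivial
  obtain ⟨f, hf, hgf⟩ := Metric.mem_closure_iff.1 hdense ε hε
  rw [dist_eq_norm] at hgf
  exact ⟨_, hspan f hf, fun n => ((g - f).norm_coe_le_norm _).trans hgf.le⟩

/-! ### Decomposition into vertical frequencies -/

section vertical

variable {F : ℝ → ℝ → ℝ → ℂ}

/-- The component of vertical frequency `-m`. -/
noncomputable def vertComponent (F : ℝ → ℝ → ℝ → ℂ) (m : ℤ) (x y z : ℝ) : ℂ :=
  ∫ t in (0 : ℝ)..1, F x y (z + t) * expi (m * t)

theorem HeisPeriodic.continuous_vertical (hF : HeisPeriodic F) (x y z : ℝ) :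
    Continuous fun t => F x y (z + t) :=
  hF.cont.comp (f := fun t : ℝ => (x, y, z + t)) (by fun_prop)

theorem HeisPeriodic.add_int (hF : HeisPeriodic F) (x y z : ℝ) (k : ℤ) :
    F x y (z + k) = F x y z := by
  have := hF.right x y z 0 0 k
  simpa using this

/-- Translate the integration variable by `s` and use that the integrand has period 1. -/
theorem vertComponent_add (hF : HeisPeriodic F) (m : ℤ) (x y z s : ℝ) :
    vertComponent F m x y (z + s) = expi ((-m : ℤ) * s) * vertComponent F m x y z := by
  unfold vertComponent
  have hper : Function.Periodic (fun t => F x y (z + t) * expi (m * t)) 1 := by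
    intro t
    have h1 := hF.add_int x y (z + t) 1
    have h2 := expi_int m
    simp only [Int.cast_one] at h1
    simp only [← add_assoc, h1, mul_add, mul_one, expi_add, h2]
  have h1 := intervalIntegral.integral_comp_add_left
    (fun t => F x y (z + t) * expi (m * t)) s (a := 0) (b := 1)
  have h2 := hper.intervalIntegral_add_eq s 0
  rw [add_zero] at h1
  rw [zero_add] at h2
  rw [h2] at h1
  rw [← h1, ← intervalIntegral.integral_const_mul]
  refine intervalIntegral.integral_congr fun t _ => ?_
  have e : expi (m * t) = expi ((-m : ℤ) * s) * expi (m * (s + t)) := by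
    rw [← expi_add]; congr 1; push_cast; ring
  rw [e, add_assoc]
  ring

theorem heisPeriodic_vertComponent (hF : HeisPeriodic F) (m : ℤ) :
    HeisPeriodic (vertComponent F m) where
  cont := by
    unfold vertComponent
    refine intervalIntegral.continuous_parametric_intervalIntegral_of_continuous' ?_ 0 1
    have h1 : Continuous fun q : (ℝ × ℝ × ℝ) × ℝ => F q.1.1 q.1.2.1 (q.1.2.2 + q.2) :=
      hF.cont.comp (f := fun q : (ℝ × ℝ × ℝ) × ℝ => (q.1.1, q.1.2.1, q.1.2.2 + q.2)) (by fun_prop)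
    exact h1.mul (continuous_expi.comp (by fun_prop))
  right x y z a b c := by
    unfold vertComponent
    refine intervalIntegral.integral_congr fun t _ => ?_
    rw [← hF.right x y (z + t) a b c]
    congr 2
    ring

/-- At frequency 0 the function descends to the torus. Otherwise it is rescaled to norm at most 1
and the correlation criterion applies. -/
theorem moebiusOrthogonal_vertical_frequency {α β : ℝ} (hαβ : LinearIndependent ℚ ![α, β, 1])
    {A B : ℤ} {h₀ : C(UnitAddTorus (Fin 2), ℝ)} {K r₀ : ℝ} (hr₀ : 0 < r₀)
    (hLip : ∀ r, 0 < r → r < r₀ → ∀ w, |h₀ (w + toTorus₂ 0 r) - h₀ w| ≤ K * r)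
    (hF : HeisPeriodic F) {m : ℤ} (hFm : ∀ x y z s, F x y (z + s) = expi (m * s) * F x y z)
    (x y z : ℝ) :
    MoebiusOrthogonal fun n : ℕ =>
      F (x + n * α) (y + n * β) (z + vertDisp α β A B h₀ n x y) := by
  by_cases hm : m = 0
  · subst hm
    have hz : ∀ x y z, F x y z = F x y 0 := by
      intro x y z
      have := hFm x y 0 z
      simpa [expi_zero] using this
    obtain ⟨φ, hφ⟩ := exists_torus_descent (fun x y => F x y 0)
      (hF.cont.comp (f := fun p : ℝ × ℝ => (p.1, p.2, (0 : ℝ))) (by fun_prop))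
      (fun x y => by
        have := hF.right x y 0 1 0 0
        rw [hz] at this
        simpa using this)
      (fun x y => by
        have := hF.right x y 0 0 1 0
        rw [hz] at this
        simpa using this)
    have := moebiusOrthogonal_torus (mFourier_toTorus₂_ne_one hαβ) φ (toTorus₂ x y)
    simp_rw [← toTorus₂_nsmul, ← toTorus₂_add, hφ] at this
    simp_rw [hz _ _ (z + _)]
    exact this
  · obtain ⟨C, hC, hFC⟩ := hF.exists_bound
    have hC' : (C : ℂ) ≠ 0 := by exact_mod_cast hC.ne'
    let F' : ℝ → ℝ → ℝ → ℂ := fun x y z => (C : ℂ)⁻¹ * F x y z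
    have hF' : HeisPeriodic F' := ⟨continuous_const.mul hF.cont, fun x y z a b c => by
      simp only [F', hF.right]⟩
    have hF'm : ∀ x y z s, F' x y (z + s) = expi (m * s) * F' x y z := fun x y z s => by
      simp only [F', hFm]; ring
    have hF'1 : ∀ x y z, ‖F' x y z‖ ≤ 1 := fun x y z => by
      simp only [F', norm_mul, norm_inv, Complex.norm_real, Real.norm_of_nonneg hC.le]
      rw [inv_mul_le_iff₀ hC, mul_one]
      exact hFC x y z
    have h1 : MoebiusOrthogonal fun n : ℕ =>
        F' (x + n * α) (y + n * β) (z + vertDisp α β A B h₀ n x y) :=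
      tendsto_moebius_of_correlations _ (fun n => hF'1 _ _ _) fun p q hp hq hpq =>
        tendsto_correlation_of_vertical_frequency hF' hF'm hF'1 hm hαβ hr₀ hLip x y z
          (fun n => rfl) hp.pos hq.pos hpq
    have h2 := h1.const_mul (C : ℂ)
    simp only [F', mul_inv_cancel_left₀ hC'] at h2
    exact h2

/-- Averaging along the fibre against a narrow tent function changes `F` little, by uniform
continuity. The tent is then replaced by a uniformly close trigonometric polynomial, so that only
finitely many vertical frequencies remain. -/
theorem exists_vertical_kernel (hF : HeisPeriodic F) {ε : ℝ} (hε : 0 < ε) :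
    ∃ (Q : C(UnitAddCircle, ℂ)) (c : ℂ), Q ∈ Submodule.span ℂ (Set.range (@fourier (1 : ℝ))) ∧
      ∀ x y z, ‖F x y z - c * ∫ t in (0 : ℝ)..1, F x y (z + t) * Q t‖ ≤ ε := by
  obtain ⟨C, hC, hFC⟩ := hF.exists_bound
  obtain ⟨δ, hδ, hδF⟩ : ∃ δ > 0, ∀ t, |t| < δ → ∀ x y z, ‖F x y (z + t) - F x y z‖ ≤ ε / 2 := by
    have h1 := hF.eventually_norm_translate_sub_lt (ε := ε / 2) (by positivity)
    have h2 : Tendsto (fun t : ℝ => ((0 : ℝ), t)) (𝓝 0) (𝓝 0) := by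
      have : Continuous fun t : ℝ => ((0 : ℝ), t) := by fun_prop
      exact this.tendsto 0
    obtain ⟨δ, hδ, h3⟩ := Metric.eventually_nhds_iff.1 (h2.eventually h1)
    refine ⟨δ, hδ, fun t ht x y z => ?_⟩
    have := h3 (y := t) (by simpa using ht) x y z
    simp only [add_zero, mul_zero, sub_zero] at this
    exact this.le
  let ρ : UnitAddCircle → ℝ := fun t => max 0 (δ - ‖t‖)
  have hρc : Continuous ρ := by fun_prop
  have hρ0 : ∀ t, 0 ≤ ρ t := fun t => le_max_left _ _
  have hcoe : Continuous fun t : ℝ => (t : UnitAddCircle) := AddCircle.continuous_mk' 1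
  have hρc' : Continuous fun t : ℝ => ρ t := hρc.comp hcoe
  set J : ℝ := ∫ t in (0 : ℝ)..1, ρ t with hJ
  have hJ0 : 0 < J := by
    refine intervalIntegral.integral_pos zero_lt_one hρc'.continuousOn (fun t _ => hρ0 t)
      ⟨0, by simp, ?_⟩
    simp [ρ, hδ]
  have hJ' : (J : ℂ) ≠ 0 := by exact_mod_cast hJ0.ne'
  let ρ' : C(UnitAddCircle, ℂ) := ⟨fun t => (ρ t : ℂ), by fun_prop⟩
  have hdense : ρ' ∈ closure (Submodule.span ℂ (Set.range (@fourier (1 : ℝ))) : Set _) := by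
    rw [← Submodule.topologicalClosure_coe, span_fourier_closure_eq_top]
    trivial
  -- The tolerance is multiplied by the bound `C` of `F` and divided by the mass `J` of the tent,
  -- leaving `ε / 2`.
  obtain ⟨Q, hQ, hρQ⟩ := Metric.mem_closure_iff.1 hdense (ε / 2 * J / C) (by positivity)
  rw [dist_eq_norm] at hρQ
  refine ⟨Q, (J : ℂ)⁻¹, hQ, fun x y z => ?_⟩
  have hFt := hF.continuous_vertical x y z
  have hQc : Continuous fun t : ℝ => Q (t : UnitAddCircle) := Q.continuous.comp hcoe
  have hi1 : IntervalIntegrable (fun t : ℝ => F x y (z + t) * (ρ t : ℂ)) volume 0 1 :=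
    (hFt.mul (Complex.continuous_ofReal.comp hρc')).intervalIntegrable _ _
  have hi2 : IntervalIntegrable (fun t : ℝ => F x y (z + t) * Q t) volume 0 1 :=
    (hFt.mul hQc).intervalIntegrable _ _
  have h1 : ‖∫ t in (0 : ℝ)..1, (F x y z - F x y (z + t)) * (ρ t : ℂ)‖ ≤ ε / 2 * J := by
    rw [hJ, ← intervalIntegral.integral_const_mul]
    refine intervalIntegral.norm_integral_le_of_norm_le zero_le_one
      (Eventually.of_forall fun t _ => ?_) ((hρc'.intervalIntegrable 0 1).const_mul _)
    rw [norm_mul, Complex.norm_real, Real.norm_of_nonneg (hρ0 _)]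
    by_cases ht : ‖(t : UnitAddCircle)‖ < δ
    · refine mul_le_mul_of_nonneg_right ?_ (hρ0 _)
      rw [UnitAddCircle.norm_eq] at ht
      -- The circle norm of `t` is `|t - round t|`, and `F` is unchanged by integer vertical shifts.
      have h2 := hδF (t - round t) ht x y z
      have h3 := hF.add_int x y (z + (t - round t)) (round t)
      rw [show z + (t - round t) + round t = z + t by ring] at h3
      rw [← h3, norm_sub_rev] at h2
      exact h2
    · have : ρ t = 0 := max_eq_left (by linarith)
      rw [this]; simp
  have h2 : ‖∫ t in (0 : ℝ)..1, F x y (z + t) * ((ρ t : ℂ) - Q t)‖ ≤ ε / 2 * J := by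
    have := intervalIntegral.norm_integral_le_of_norm_le_const (a := 0) (b := 1)
      (C := C * (ε / 2 * J / C)) (f := fun t : ℝ => F x y (z + t) * ((ρ t : ℂ) - Q t))
      (fun t _ => by
        rw [norm_mul]
        refine mul_le_mul (hFC _ _ _) ?_ (norm_nonneg _) hC.le
        exact ((ρ' - Q).norm_coe_le_norm t).trans hρQ.le)
    rw [sub_zero, abs_one, mul_one, mul_div_cancel₀ _ hC.ne'] at this
    exact this
  have e1 : ∫ t in (0 : ℝ)..1, (F x y z - F x y (z + t)) * (ρ t : ℂ) =
      F x y z * J - ∫ t in (0 : ℝ)..1, F x y (z + t) * (ρ t : ℂ) := by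
    rw [hJ, ← intervalIntegral.integral_ofReal, ← intervalIntegral.integral_const_mul,
      ← intervalIntegral.integral_sub]
    · simp_rw [sub_mul]
    · exact Continuous.intervalIntegrable (by fun_prop) _ _
    · exact hi1
  have e2 : ∫ t in (0 : ℝ)..1, F x y (z + t) * ((ρ t : ℂ) - Q t) =
      (∫ t in (0 : ℝ)..1, F x y (z + t) * (ρ t : ℂ)) -
        ∫ t in (0 : ℝ)..1, F x y (z + t) * Q t := by
    rw [← intervalIntegral.integral_sub hi1 hi2]
    simp_rw [mul_sub]
  have e3 : F x y z - (J : ℂ)⁻¹ * ∫ t in (0 : ℝ)..1, F x y (z + t) * Q t =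
      (J : ℂ)⁻¹ * ((∫ t in (0 : ℝ)..1, (F x y z - F x y (z + t)) * (ρ t : ℂ)) +
        ∫ t in (0 : ℝ)..1, F x y (z + t) * ((ρ t : ℂ) - Q t)) := by
    rw [e1, e2]
    field_simp
    ring
  rw [e3, norm_mul, norm_inv, Complex.norm_real, Real.norm_of_nonneg hJ0.le, inv_mul_le_iff₀ hJ0]
  refine (norm_add_le _ _).trans ?_
  linarith

theorem moebiusOrthogonal_heisPeriodic {α β : ℝ} (hαβ : LinearIndependent ℚ ![α, β, 1])
    {A B : ℤ} {h₀ : C(UnitAddTorus (Fin 2), ℝ)} {K r₀ : ℝ} (hr₀ : 0 < r₀)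
    (hLip : ∀ r, 0 < r → r < r₀ → ∀ w, |h₀ (w + toTorus₂ 0 r) - h₀ w| ≤ K * r)
    (hF : HeisPeriodic F) (x y z : ℝ) :
    MoebiusOrthogonal fun n : ℕ =>
      F (x + n * α) (y + n * β) (z + vertDisp α β A B h₀ n x y) := by
  have hcoe : Continuous fun t : ℝ => (t : UnitAddCircle) := AddCircle.continuous_mk' 1
  have h_int : ∀ (Q : C(UnitAddCircle, ℂ)) (x y z : ℝ),
      IntervalIntegrable (fun t => F x y (z + t) * Q t) volume 0 1 := fun Q x y z =>
    ((hF.continuous_vertical x y z).mul (Q.continuous.comp hcoe)).intervalIntegrable _ _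
  have hspan : ∀ Q ∈ Submodule.span ℂ (Set.range (@fourier (1 : ℝ))),
      MoebiusOrthogonal fun n : ℕ => ∫ t in (0 : ℝ)..1,
        F (x + n * α) (y + n * β) (z + vertDisp α β A B h₀ n x y + t) * Q (t : UnitAddCircle) := by
    intro Q hQ
    induction hQ using Submodule.span_induction with
    | mem Q hQ =>
      obtain ⟨m, rfl⟩ := hQ
      have h1 := moebiusOrthogonal_vertical_frequency hαβ (A := A) (B := B) hr₀ hLip
        (heisPeriodic_vertComponent hF m) (vertComponent_add hF m) x y z
      unfold vertComponent at h1
      have e : ∀ t : ℝ, fourier m (t : UnitAddCircle) = expi (m * t) := by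
        intro t
        rw [fourier_coe_apply]
        unfold expi
        congr 1
        push_cast; ring
      simp_rw [e]
      exact h1
    | zero => simpa using MoebiusOrthogonal.zero
    | add f g _ _ hf hg =>
      simp only [ContinuousMap.add_apply, mul_add]
      simp_rw [intervalIntegral.integral_add (h_int f _ _ _) (h_int g _ _ _)]
      exact hf.add hg
    | smul c f _ hf =>
      simp only [ContinuousMap.smul_apply, smul_eq_mul, mul_left_comm _ c,
        intervalIntegral.integral_const_mul]
      exact hf.const_mul c
  refine MoebiusOrthogonal.of_uniform_approx fun ε hε => ?_
  obtain ⟨Q, c, hQ, hFQ⟩ := exists_vertical_kernel hF hε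
  exact ⟨_, (hspan Q hQ).const_mul c, fun n => hFQ _ _ _⟩

end vertical

/-! ### Transfer to the nilmanifold -/

theorem heisPeriodic_of_continuous (f : C(HeisNil, ℂ)) :
    HeisPeriodic fun x y z => f (QuotientGroup.mk (⟨x, y, z⟩ : Heis)) where
  cont := by
    have h1 : Continuous fun p : ℝ × ℝ × ℝ => (⟨p.1, p.2.1, p.2.2⟩ : Heis) :=
      continuous_induced_rng.2 continuous_id
    exact f.continuous.comp (continuous_quot_mk.comp h1)
  right x y z a b c := by
    congr 1
    have hmem : (⟨x, y, z⟩ : Heis)⁻¹ * ⟨x + a, y + b, z + c + (x * b - a * y)⟩ ∈ Heis.lattice := by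
      refine ⟨a, b, c, ?_⟩
      simp only [Heis.mul_def, Heis.inv_def]
      ext <;> simp only [] <;> ring
    exact (QuotientGroup.eq.2 hmem).symm

theorem iterate_skew_mk {α β : ℝ} {h : UnitAddCircle × UnitAddCircle → UnitAddCircle} {A B : ℤ}
    {h₀ : C(UnitAddTorus (Fin 2), ℝ)}
    (hh₀ : ∀ x y : ℝ, ((h₀ (toTorus₂ x y) + A * x + B * y : ℝ) : UnitAddCircle) = h (x, y))
    (x y z : ℝ) (n : ℕ) :
    (HeisNil.skew α β h)^[n] (QuotientGroup.mk (⟨x, y, z⟩ : Heis)) = QuotientGroup.mk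
      (⟨x + n * α, y + n * β, z + vertDisp α β A B h₀ n x y⟩ : Heis) := by
  induction n with
  | zero => simp [vertDisp]
  | succ n ih =>
    -- Independence of the lift permits using `h₀ + Ax + By` in place of the representative in
    -- `[0,1)`.
    rw [Function.iterate_succ_apply', ih, HeisNil.skew_mk _ _ _ _ _ (hh₀ _ _)]
    congr 1
    rw [vertDisp_add, Heis.mul_def]
    simp only [vertDisp, sum_range_one]
    ext
    · push_cast; ring
    · push_cast; ring
    · push_cast; ring_nf

theorem theorem1p1 (α β : ℝ) (hαβ : LinearIndependent ℚ ![α, β, 1])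
    (h : UnitAddCircle × UnitAddCircle → UnitAddCircle) (hh : ∃ K : NNReal, LipschitzWith K h)
    (p : HeisNil) (f : C(HeisNil, ℂ)) :
    Filter.Tendsto
      (fun N : ℕ => (1 / (N : ℂ)) * ∑ n ∈ Finset.Icc 1 N,
        f ((HeisNil.skew α β h)^[n] p) * (ArithmeticFunction.moebius n : ℂ))
      Filter.atTop (nhds 0) := by
  obtain ⟨K, hK⟩ := hh
  obtain ⟨A, B, h₀, hh₀⟩ := exists_torus_lift h hK.continuous
  obtain ⟨r₀, hr₀, hLip⟩ := exists_vertical_lipschitz hK hh₀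
  obtain ⟨⟨x, y, z⟩, rfl⟩ := QuotientGroup.mk_surjective p
  simp_rw [iterate_skew_mk hh₀]
  exact moebiusOrthogonal_heisPeriodic hαβ hr₀ hLip (heisPeriodic_of_continuous f) x y z
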